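/- Let $0<p<1$. Consider the two-receiver discrete memoryless broadcast channel with state, with input alphabet $\mathcal X=\{1,2,3,4\}$ and i.i.d. state $S\in\{0,1,2,3,4\}$, $P(S=0)=1-p$ and $P(S=s)=p/4$ for $s=1,2,3,4$ (a memory with stuck faults): $Y_1=X$ if $S=0$ and $Y_1=S$ otherwise, while $Y_2=0$ if $Y_1\in\{1,2\}$ and $Y_2=1$ if $Y_1\in\{3,4\}$. The encoder knows the whole state sequence noncausally; it sends a common message $M_0$ and private messages $M_1,M_2$ of rates $R_0,R_1,R_2\ge 0$ (in bits per channel use) so that receiver 1, who knows $M_2$, recovers $(M_0,M_1)$ and receiver 2, who knows $M_1$, recovers $(M_0,M_2)$. The capacity region $\mathcal C$ is the closure of the set of rate tuples for which there are codes of block length $n$ whose average error probability tends to $0$ as $n\to\infty$. Then: (a) $\mathcal C=\{(R_0,R_1,R_2)\in\mathbb R_{\ge 0}^3: R_0+R_1\le 2-2p,\ R_0+R_2\le 1-p\}$. (b) Let $\mathcal R_{\mathrm{new}}$ be the union, over all finite-alphabet random variables $V_1,V_2$ jointly distributed with $S$ and all functions $X=f(V_1,V_2,S)$ such that $(V_1,V_2)\to(X,S)\to(Y_1,Y_2)$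 is a Markov chain, $I(V_2;Y_1|V_1)>I(V_2;S|V_1)$, $I(V_1;Y_1)>I(V_1;S)$ and $I(V_1;Y_2)>I(V_1;S)$, of the sets of nonnegative rate tuples with $$R_0+R_1\le I(V_1,V_2;Y_1)-I(V_1,V_2;S),\qquad R_0+R_2\le I(V_1;Y_2)-I(V_1;S).$$ Then $\mathcal R_{\mathrm{new}}=\mathcal C$, and the equality still holds when $V_1$ and $V_2$ are required to be binary. (c) Let $\mathcal R_{\mathrm{GP}}$ be the union, over all finite-alphabet random variables $U$ jointly distributed with $S$ and all functions $X=x(U,S)$ such that $U\to(X,S)\to(Y_1,Y_2)$ is a Markov chain, of the sets of nonnegative rate tuples with $$R_0+R_1\le I(U;Y_1)-I(U;S),\qquad R_0+R_2\le I(U;Y_2)-I(U;S).$$ Then $\mathcal R_{\mathrm{GP}}$, and even its closure, is a proper subset of $\mathcal C$. -/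

import Mathlib

open Filter Topology

noncomputable section

namespace BCSI

/-! Information measures, in bits, of random variables `f, g, h` on a finite sample space `Ω`
carrying the probability mass function `P`. -/

section Info

variable {Ω α β γ : Type} [Fintype Ω] [Fintype α] [Fintype β] [Fintype γ]
  [DecidableEq α] [DecidableEq β] [DecidableEq γ]

/-- The probability that `f = a`. -/
def prob (P : Ω → ℝ) (f : Ω → α) (a : α) : ℝ := ∑ ω, if f ω = a then P ω else 0

/-- The Shannon entropy `H(f)` in bits (with `0 log 0 = 0`). -/
def entropy (P : Ω → ℝ) (f : Ω → α) : ℝ := ∑ a, -(prob P f a * Real.logb 2 (prob P f a))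

/-- The conditional entropy `H(f | g)`. -/
def condEntropy (P : Ω → ℝ) (f : Ω → α) (g : Ω → β) : ℝ :=
  entropy P (fun ω => (f ω, g ω)) - entropy P g

/-- The mutual information `I(f ; g)`. -/
def mutualInfo (P : Ω → ℝ) (f : Ω → α) (g : Ω → β) : ℝ := entropy P f - condEntropy P f g

/-- The conditional mutual information `I(f ; g | h)`. -/
def condMutualInfo (P : Ω → ℝ) (f : Ω → α) (g : Ω → β) (h : Ω → γ) : ℝ :=
  condEntropy P f h - condEntropy P f (fun ω => (g ω, h ω))

end Info

/-- A two-receiver discrete memoryless broadcast channel with random state: the pmf of the state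
and the transition probabilities `trans x s (y₁, y₂) = P(y₁, y₂ | x, s)`. -/
structure Channel (X S Y₁ Y₂ : Type) [Fintype S] [Fintype Y₁] [Fintype Y₂] where
  stateLaw : S → ℝ
  stateLaw_mem : stateLaw ∈ stdSimplex ℝ S
  trans : X → S → Y₁ × Y₂ → ℝ
  trans_mem : ∀ x s, trans x s ∈ stdSimplex ℝ (Y₁ × Y₂)

/-- A code of block length `n` with `M₀`, `M₁`, `M₂` messages. The encoder knows the whole state
sequence; receiver 1 knows the second private message and receiver 2 the first one. -/
structure Code (X S Y₁ Y₂ : Type) (n M₀ M₁ M₂ : ℕ) where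
  enc : Fin M₀ × Fin M₁ × Fin M₂ → (Fin n → S) → (Fin n → X)
  dec₁ : (Fin n → Y₁) → Fin M₂ → Fin M₀ × Fin M₁
  dec₂ : (Fin n → Y₂) → Fin M₁ → Fin M₀ × Fin M₂

namespace Channel

variable {X S Y₁ Y₂ : Type} [Fintype S] [Fintype Y₁] [Fintype Y₂]

/-- The average error probability: the messages are uniform and independent of the i.i.d. state
sequence, and an error occurs if at least one of the receivers decodes incorrectly. -/
def errorProb (C : Channel X S Y₁ Y₂) {n M₀ M₁ M₂ : ℕ} (c : Code X S Y₁ Y₂ n M₀ M₁ M₂) : ℝ :=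
  (∑ m : Fin M₀ × Fin M₁ × Fin M₂, ∑ s : Fin n → S, ∑ y : Fin n → Y₁ × Y₂,
    if c.dec₁ (fun i => (y i).1) m.2.2 ≠ (m.1, m.2.1) ∨
        c.dec₂ (fun i => (y i).2) m.2.1 ≠ (m.1, m.2.2)
    then (∏ i, C.stateLaw (s i)) * ∏ i, C.trans (c.enc m s i) (s i) (y i)
    else 0) / ((M₀ : ℝ) * M₁ * M₂)

/-- The rate tuple `(R 0, R 1, R 2)` is achievable: there is a sequence of
`(2^{nR₀}, 2^{nR₁}, 2^{nR₂}, n)` codes (numbers of messages rounded up to integers) whose average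
error probability tends to zero. -/
def Achievable (C : Channel X S Y₁ Y₂) (R : Fin 3 → ℝ) : Prop :=
  ∃ c : ∀ n : ℕ, Code X S Y₁ Y₂ n ⌈(2 : ℝ) ^ ((n : ℝ) * R 0)⌉₊ ⌈(2 : ℝ) ^ ((n : ℝ) * R 1)⌉₊
      ⌈(2 : ℝ) ^ ((n : ℝ) * R 2)⌉₊,
    Tendsto (fun n => C.errorProb (c n)) atTop (𝓝 0)

/-- The capacity region: the closure of the set of achievable (nonnegative) rate tuples. -/
def capacityRegion (C : Channel X S Y₁ Y₂) : Set (Fin 3 → ℝ) :=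
  closure {R | (∀ i, 0 ≤ R i) ∧ C.Achievable R}

/-- The joint law of `(U, S, Y₁, Y₂)` when `U` has conditional pmf `q s` given `S = s`, the channel
input is `X = f (U, S)`, and `(Y₁, Y₂)` is the channel output; in particular
`U → (X, S) → (Y₁, Y₂)` is a Markov chain. -/
def jointLaw (C : Channel X S Y₁ Y₂) {U : Type} (q : S → U → ℝ) (f : U → S → X) :
    U × S × Y₁ × Y₂ → ℝ :=
  fun ω => C.stateLaw ω.2.1 * q ω.2.1 ω.1 * C.trans (f ω.1 ω.2.1) ω.2.1 ω.2.2

variable [DecidableEq S] [DecidableEq Y₁] [DecidableEq Y₂]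

/-- The straightforward extension of the Gelfand-Pinsker result: the union, over all auxiliary
variables `U` with a finite alphabet, all `P(u | s)` and all functions `x(u, s)`, of the sets
`R₀ + R₁ ≤ I(U; Y₁) - I(U; S)`, `R₀ + R₂ ≤ I(U; Y₂) - I(U; S)`. -/
def gelfandPinskerRegion (C : Channel X S Y₁ Y₂) : Set (Fin 3 → ℝ) :=
  {R | (∀ i, 0 ≤ R i) ∧ ∃ (k : ℕ) (q : S → Fin k → ℝ) (f : Fin k → S → X),
    (∀ s, q s ∈ stdSimplex ℝ (Fin k)) ∧
    R 0 + R 1 ≤ mutualInfo (C.jointLaw q f) (fun ω => ω.1) (fun ω => ω.2.2.1)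
      - mutualInfo (C.jointLaw q f) (fun ω => ω.1) (fun ω => ω.2.1) ∧
    R 0 + R 2 ≤ mutualInfo (C.jointLaw q f) (fun ω => ω.1) (fun ω => ω.2.2.2)
      - mutualInfo (C.jointLaw q f) (fun ω => ω.1) (fun ω => ω.2.1)}

/-- The two-layer region with auxiliary alphabets of sizes `k₁`, `k₂`: the union over all
`P(v₁, v₂ | s)` and all functions `x = f(v₁, v₂, s)` with
`I(V₂; Y₁ | V₁) > I(V₂; S | V₁)`, `I(V₁; Y₁) > I(V₁; S)`, `I(V₁; Y₂) > I(V₁; S)` of the sets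
`R₁ + R₀ ≤ I(V₁, V₂; Y₁) - I(V₁, V₂; S)`, `R₂ + R₀ ≤ I(V₁; Y₂) - I(V₁; S)`. -/
def twoLayerRegionOfSize (C : Channel X S Y₁ Y₂) (k₁ k₂ : ℕ) : Set (Fin 3 → ℝ) :=
  {R | (∀ i, 0 ≤ R i) ∧ ∃ (q : S → Fin k₁ × Fin k₂ → ℝ) (f : Fin k₁ × Fin k₂ → S → X),
    (∀ s, q s ∈ stdSimplex ℝ (Fin k₁ × Fin k₂)) ∧
    condMutualInfo (C.jointLaw q f) (fun ω => ω.1.2) (fun ω => ω.2.2.1) (fun ω => ω.1.1) >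
      condMutualInfo (C.jointLaw q f) (fun ω => ω.1.2) (fun ω => ω.2.1) (fun ω => ω.1.1) ∧
    mutualInfo (C.jointLaw q f) (fun ω => ω.1.1) (fun ω => ω.2.2.1) >
      mutualInfo (C.jointLaw q f) (fun ω => ω.1.1) (fun ω => ω.2.1) ∧
    mutualInfo (C.jointLaw q f) (fun ω => ω.1.1) (fun ω => ω.2.2.2) >
      mutualInfo (C.jointLaw q f) (fun ω => ω.1.1) (fun ω => ω.2.1) ∧
    R 1 + R 0 ≤ mutualInfo (C.jointLaw q f) (fun ω => ω.1) (fun ω => ω.2.2.1)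
      - mutualInfo (C.jointLaw q f) (fun ω => ω.1) (fun ω => ω.2.1) ∧
    R 2 + R 0 ≤ mutualInfo (C.jointLaw q f) (fun ω => ω.1.1) (fun ω => ω.2.2.2)
      - mutualInfo (C.jointLaw q f) (fun ω => ω.1.1) (fun ω => ω.2.1)}

/-- The two-layer region, with arbitrary finite auxiliary alphabets. -/
def twoLayerRegion (C : Channel X S Y₁ Y₂) : Set (Fin 3 → ℝ) :=
  ⋃ (k₁ : ℕ) (k₂ : ℕ), C.twoLayerRegionOfSize k₁ k₂

end Channel

/-- The merging map `1, 2 ↦ 0` and `3, 4 ↦ 1`; the symbols `1, 2, 3, 4` are the elements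
`0, 1, 2, 3` of `Fin 4`. -/
def merge (y : Fin 4) : Fin 2 := if y.val < 2 then 0 else 1

/-- The first output of the memory with stuck faults: `none` is the fault-free state (state `0`),
in which the input is received; in state `some j` the cell is stuck at `j`. -/
def stuckOutput (x : Fin 4) (s : Option (Fin 4)) : Fin 4 := s.getD x

/-- The stuck-fault broadcast channel with total fault probability `p`: `Y₁` is the content of the
memory cell and `Y₂` is the merged version of `Y₁`. -/
def stuckFaultChannel (p : ℝ) (hp : p ∈ Set.Icc (0 : ℝ) 1) :
    Channel (Fin 4) (Option (Fin 4)) (Fin 4) (Fin 2) where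
  stateLaw s := s.elim (1 - p) (fun _ => p / 4)
  stateLaw_mem := by
    refine ⟨fun s => ?_, ?_⟩
    · cases s with
      | none => simpa using hp.2
      | some j => exact div_nonneg hp.1 (by norm_num)
    · rw [Fintype.sum_option]
      simp
      ring
  trans x s y := if y = (stuckOutput x s, merge (stuckOutput x s)) then 1 else 0
  trans_mem x s := by
    refine ⟨fun y => ?_, ?_⟩
    · dsimp only
      split_ifs <;> norm_num
    · simp

end BCSI

end

set_option linter.unusedSectionVars false

noncomputable section

namespace BCSI

/-! ### Entropy calculus on finite sample spaces: Gibbs, submodularity, continuity. -/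

section InformationMeasures

variable {Ω Ω' α β γ ι : Type} [Fintype Ω] [Fintype Ω'] [Fintype α] [Fintype β] [Fintype γ]
  [Fintype ι] [DecidableEq Ω'] [DecidableEq α] [DecidableEq β] [DecidableEq γ]

/-! Single-letter bounds: `I(U;Y) - I(U;S) ≤ H(Y|S)`, and only the fault-free state contributes to
`H(Y|S)`, so the rates are at most `(1-p) log |Y|`, that is `2-2p` and `1-p`. Two layers attain both
bounds at once: let `V₁` and `V₂` be the merged bit and the parity of the final content of the cell,
the content being uniform in the fault-free state. Receiver 1 sees both and receiver 2 sees `V₁`, so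
nothing is lost (`stuckFaultRegion_subset`).

One auxiliary variable cannot do this. It may be replaced by the input it prescribes in the
fault-free state, which makes the parameter set compact. Tightness of both bounds would make `U` and
`S` independent given `Y₁` and also given `Y₂`; the first forbids an event that the second forces to
have positive probability (`inputRate_lt_or_lt`). Compactness turns strictness into a uniform gap,
which survives closure.

The capacity is found by counting words that agree with the stuck cells. For a given state sequence
the outputs are such words, so few messages can be decoded when the rate is too high (`success_le`).
Conversely, random binning of the merged bits and of the parities gives two binary memories, each of
capacity `1-p` (`exists_code`); the surplus of `m₁` shares the first one with `m₂` by modular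
addition, since each receiver knows the other's message. Both directions rest on a fractional moment
of the number of these words and on the exponent of `exists_rpow_lt_one`. -/

lemma prob_nonneg {P : Ω → ℝ} (hP : ∀ ω, 0 ≤ P ω) (f : Ω → α) (a : α) : 0 ≤ prob P f a :=
  Finset.sum_nonneg fun ω _ => by split_ifs <;> simp [hP ω]

lemma sum_prob_mul (P : Ω → ℝ) (f : Ω → α) (w : α → ℝ) :
    ∑ a, prob P f a * w a = ∑ ω, P ω * w (f ω) := by
  simp only [prob, Finset.sum_mul]
  rw [Finset.sum_comm]
  refine Finset.sum_congr rfl fun ω _ => ?_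
  simp [ite_mul]

lemma sum_prob (P : Ω → ℝ) (f : Ω → α) : ∑ a, prob P f a = ∑ ω, P ω := by
  simpa using sum_prob_mul P f fun _ => 1

lemma prob_prob (P : Ω → ℝ) (φ : Ω → Ω') (f : Ω' → α) (a : α) :
    prob (prob P φ) f a = prob P (fun ω => f (φ ω)) a := by
  have := sum_prob_mul P φ fun z => if f z = a then 1 else 0
  simpa [prob] using this

lemma entropy_prob (P : Ω → ℝ) (φ : Ω → Ω') (f : Ω' → α) :
    entropy (prob P φ) f = entropy P fun ω => f (φ ω) := by
  simp only [entropy, prob_prob]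

lemma sum_prob_prod_left (P : Ω → ℝ) (f : Ω → α) (g : Ω → β) (b : β) :
    ∑ a, prob P (fun ω => (f ω, g ω)) (a, b) = prob P g b := by
  simp only [prob, Prod.mk.injEq]
  rw [Finset.sum_comm]
  refine Finset.sum_congr rfl fun ω _ => ?_
  by_cases h : g ω = b <;> simp [h]

lemma sum_prob_prod_right (P : Ω → ℝ) (f : Ω → α) (g : Ω → β) (a : α) :
    ∑ b, prob P (fun ω => (f ω, g ω)) (a, b) = prob P f a := by
  simp only [prob, Prod.mk.injEq]
  rw [Finset.sum_comm]
  refine Finset.sum_congr rfl fun ω _ => ?_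
  by_cases h : f ω = a <;> simp [h]

lemma prob_le_prob_comp {P : Ω → ℝ} (hP : ∀ ω, 0 ≤ P ω) (f : Ω → α) (φ : α → β) (a : α) :
    prob P f a ≤ prob P (fun ω => φ (f ω)) (φ a) := by
  refine Finset.sum_le_sum fun ω _ => ?_
  by_cases h : f ω = a
  · simp [h]
  · rw [if_neg h]
    split_ifs <;> simp [hP ω]

/-- The entropy of a function of `f`, as an expectation with respect to the law of `f`. -/
lemma entropy_comp (P : Ω → ℝ) (f : Ω → α) (φ : α → β) :
    entropy P (fun ω => φ (f ω)) =
      -∑ a, prob P f a * Real.logb 2 (prob P (fun ω => φ (f ω)) (φ a)) := by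
  rw [entropy, Finset.sum_neg_distrib, sum_prob_mul P f,
    sum_prob_mul P (fun ω => φ (f ω)) fun b => Real.logb 2 (prob P (fun ω => φ (f ω)) b)]

lemma entropy_comp_le {P : Ω → ℝ} (hP : ∀ ω, 0 ≤ P ω) (f : Ω → α) (φ : α → β) :
    entropy P (fun ω => φ (f ω)) ≤ entropy P f := by
  rw [entropy_comp, entropy, Finset.sum_neg_distrib, neg_le_neg_iff]
  refine Finset.sum_le_sum fun a _ => ?_
  rcases (prob_nonneg hP f a).eq_or_lt with h | h
  · simp [← h]
  · refine mul_le_mul_of_nonneg_left ?_ h.le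
    exact Real.logb_le_logb_of_le (by norm_num) h (prob_le_prob_comp hP f φ a)

lemma entropy_le_of_comp {P : Ω → ℝ} (hP : ∀ ω, 0 ≤ P ω) (f : Ω → α) (g : Ω → β) (φ : α → β)
    (h : ∀ ω, g ω = φ (f ω)) : entropy P g ≤ entropy P f := by
  rw [funext h]
  exact entropy_comp_le hP f φ

lemma entropy_congr {P : Ω → ℝ} (hP : ∀ ω, 0 ≤ P ω) (f : Ω → α) (g : Ω → β) (φ : α → β)
    (ψ : β → α) (h : ∀ ω, g ω = φ (f ω)) (h' : ∀ ω, f ω = ψ (g ω)) :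
    entropy P g = entropy P f :=
  le_antisymm (entropy_le_of_comp hP f g φ h) (entropy_le_of_comp hP g f ψ h')

/-- As `klFun` is nonnegative and vanishes only at 1, this identity gives both Gibbs' inequality and
its equality case. For `y = 0` it needs absolute continuity. -/
lemma mul_logb_div_eq_klFun {x y : ℝ} (h : y = 0 → x = 0) :
    x * Real.logb 2 (x / y) =
      (y * InformationTheory.klFun (x / y) + x - y) / Real.log 2 := by
  rcases eq_or_ne y 0 with hy | hy
  · simp [hy, h hy]
  · rw [InformationTheory.klFun, Real.logb]
    field_simp
    ring

/-- Gibbs' inequality for two finite measures of the same mass. -/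
lemma sum_mul_logb_div_nonneg {x y : ι → ℝ} (hx : ∀ i, 0 ≤ x i) (hy : ∀ i, 0 ≤ y i)
    (h : ∀ i, y i = 0 → x i = 0) (hs : ∑ i, x i = ∑ i, y i) :
    0 ≤ ∑ i, x i * Real.logb 2 (x i / y i) := by
  simp only [fun i => mul_logb_div_eq_klFun (h i)]
  rw [← Finset.sum_div, Finset.sum_sub_distrib, Finset.sum_add_distrib, hs, add_sub_cancel_right]
  refine div_nonneg (Finset.sum_nonneg fun i _ => ?_) (Real.log_nonneg (by norm_num))
  exact mul_nonneg (hy i) (InformationTheory.klFun_nonneg (div_nonneg (hx i) (hy i)))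

/-- The equality case of Gibbs' inequality. -/
lemma eq_of_sum_mul_logb_div_nonpos {x y : ι → ℝ} (hx : ∀ i, 0 ≤ x i) (hy : ∀ i, 0 ≤ y i)
    (h : ∀ i, y i = 0 → x i = 0) (hs : ∑ i, x i = ∑ i, y i)
    (h0 : ∑ i, x i * Real.logb 2 (x i / y i) ≤ 0) (i : ι) : x i = y i := by
  simp only [fun i => mul_logb_div_eq_klFun (h i)] at h0
  rw [← Finset.sum_div, Finset.sum_sub_distrib, Finset.sum_add_distrib, hs,
    add_sub_cancel_right] at h0
  have hnn : ∀ j ∈ Finset.univ, 0 ≤ y j * InformationTheory.klFun (x j / y j) := fun j _ =>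
    mul_nonneg (hy j) (InformationTheory.klFun_nonneg (div_nonneg (hx j) (hy j)))
  have hlog : (0 : ℝ) < Real.log 2 := Real.log_pos (by norm_num)
  have hz : ∑ j, y j * InformationTheory.klFun (x j / y j) = 0 := by
    refine le_antisymm ?_ (Finset.sum_nonneg hnn)
    by_contra hc
    exact absurd h0 (not_le.2 (div_pos (not_le.1 hc) hlog))
  have hi := (Finset.sum_eq_zero_iff_of_nonneg hnn).1 hz i (Finset.mem_univ i)
  rcases mul_eq_zero.1 hi with h1 | h1
  · rw [h1, h i h1]
  · rw [InformationTheory.klFun_eq_zero_iff (div_nonneg (hx i) (hy i))] at h1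
    by_cases hyi : y i = 0
    · simp [hyi] at h1
    · rwa [div_eq_one_iff_eq hyi] at h1

section Submodularity

variable (P : Ω → ℝ) (f : Ω → α) (g : Ω → β) (h : Ω → γ)

/-- The defect is the conditional mutual information of `f` and `h` given `g`, written as the
divergence of the joint law from the law with the same marginals that makes them conditionally
independent. -/
lemma submodularity_defect (hP : ∀ ω, 0 ≤ P ω) :
    entropy P (fun ω => (f ω, g ω)) + entropy P (fun ω => (g ω, h ω))
        - entropy P (fun ω => (f ω, g ω, h ω)) - entropy P g =
      ∑ z : α × β × γ, prob P (fun ω => (f ω, g ω, h ω)) z *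
        Real.logb 2 (prob P (fun ω => (f ω, g ω, h ω)) z /
          (prob P (fun ω => (f ω, g ω)) (z.1, z.2.1) * prob P (fun ω => (g ω, h ω)) z.2 /
            prob P g z.2.1)) := by
  have e1 := entropy_comp P (fun ω => (f ω, g ω, h ω)) fun z => (z.1, z.2.1)
  have e2 := entropy_comp P (fun ω => (f ω, g ω, h ω)) fun z => z.2
  have e3 := entropy_comp P (fun ω => (f ω, g ω, h ω)) fun z => z
  have e4 := entropy_comp P (fun ω => (f ω, g ω, h ω)) fun z => z.2.1
  dsimp only at e1 e2 e3 e4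
  rw [e1, e2, e3, e4, sub_neg_eq_add, sub_neg_eq_add, ← sub_eq_add_neg, ← sub_eq_zero,
    ← Finset.sum_neg_distrib, ← Finset.sum_sub_distrib, ← Finset.sum_add_distrib,
    ← Finset.sum_add_distrib, ← Finset.sum_sub_distrib]
  refine Finset.sum_eq_zero fun z _ => ?_
  rcases (prob_nonneg hP (fun ω => (f ω, g ω, h ω)) z).eq_or_lt with hz | hz
  · simp [← hz]
  have h1 := hz.trans_le (prob_le_prob_comp hP (fun ω => (f ω, g ω, h ω)) (fun z => (z.1, z.2.1)) z)
  have h2 := hz.trans_le (prob_le_prob_comp hP (fun ω => (f ω, g ω, h ω)) (fun z => z.2) z)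
  have h4 := hz.trans_le (prob_le_prob_comp hP (fun ω => (f ω, g ω, h ω)) (fun z => z.2.1) z)
  dsimp only at h1 h2 h4
  rw [Real.logb_div hz.ne' (by positivity), Real.logb_div (by positivity) h4.ne',
    Real.logb_mul h1.ne' h2.ne']
  ring

lemma sum_prob_mul_prob_div (P : Ω → ℝ) (f : Ω → α) (g : Ω → β) (h : Ω → γ) :
    ∑ z : α × β × γ, prob P (fun ω => (f ω, g ω)) (z.1, z.2.1) *
      prob P (fun ω => (g ω, h ω)) z.2 / prob P g z.2.1 = ∑ ω, P ω := by
  rw [Fintype.sum_prod_type, Finset.sum_comm, Fintype.sum_prod_type]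
  dsimp only
  -- `x * x / x = x` also holds at 0, so values of `g` of probability zero need no separate case.
  simp_rw [← Finset.sum_div, ← Finset.sum_mul, sum_prob_prod_left,
    ← Finset.mul_sum, sum_prob_prod_right, mul_self_div_self]
  exact sum_prob P g

lemma prob_prod_eq_zero {P : Ω → ℝ} (hP : ∀ ω, 0 ≤ P ω) (z : α × β × γ)
    (hz : prob P (fun ω => (f ω, g ω)) (z.1, z.2.1) * prob P (fun ω => (g ω, h ω)) z.2 /
      prob P g z.2.1 = 0) : prob P (fun ω => (f ω, g ω, h ω)) z = 0 := by
  have h1 := prob_le_prob_comp hP (fun ω => (f ω, g ω, h ω)) (fun z => (z.1, z.2.1)) z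
  have h2 := prob_le_prob_comp hP (fun ω => (f ω, g ω, h ω)) (fun z => z.2) z
  have h4 := prob_le_prob_comp hP (fun ω => (f ω, g ω, h ω)) (fun z => z.2.1) z
  dsimp only at h1 h2 h4
  have h0 := prob_nonneg hP (fun ω => (f ω, g ω, h ω)) z
  rcases div_eq_zero_iff.1 hz with hz | hz
  · rcases mul_eq_zero.1 hz with hz | hz <;> linarith
  · linarith

lemma prob_mul_prob_div_nonneg {P : Ω → ℝ} (hP : ∀ ω, 0 ≤ P ω) (z : α × β × γ) :
    0 ≤ prob P (fun ω => (f ω, g ω)) (z.1, z.2.1) * prob P (fun ω => (g ω, h ω)) z.2 /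
      prob P g z.2.1 :=
  div_nonneg (mul_nonneg (prob_nonneg hP _ _) (prob_nonneg hP _ _)) (prob_nonneg hP _ _)

/-- Submodularity of the entropy. -/
lemma entropy_submodular {P : Ω → ℝ} (hP : ∀ ω, 0 ≤ P ω) :
    entropy P (fun ω => (f ω, g ω, h ω)) + entropy P g ≤
      entropy P (fun ω => (f ω, g ω)) + entropy P (fun ω => (g ω, h ω)) := by
  have h1 := submodularity_defect P f g h hP
  have h2 := sum_mul_logb_div_nonneg (prob_nonneg hP (fun ω => (f ω, g ω, h ω)))
    (prob_mul_prob_div_nonneg f g h hP) (prob_prod_eq_zero f g h hP)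
    (by rw [sum_prob_mul_prob_div, sum_prob])
  linarith

/-- Equality in the submodularity of the entropy forces conditional independence. -/
lemma prob_eq_of_entropy_le {P : Ω → ℝ} (hP : ∀ ω, 0 ≤ P ω)
    (hle : entropy P (fun ω => (f ω, g ω)) + entropy P (fun ω => (g ω, h ω)) ≤
      entropy P (fun ω => (f ω, g ω, h ω)) + entropy P g) (a : α) (b : β) (c : γ) :
    prob P (fun ω => (f ω, g ω, h ω)) (a, b, c) =
      prob P (fun ω => (f ω, g ω)) (a, b) * prob P (fun ω => (g ω, h ω)) (b, c) / prob P g b := by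
  have h1 := submodularity_defect P f g h hP
  exact eq_of_sum_mul_logb_div_nonpos (prob_nonneg hP (fun ω => (f ω, g ω, h ω)))
    (prob_mul_prob_div_nonneg f g h hP) (prob_prod_eq_zero f g h hP)
    (by rw [sum_prob_mul_prob_div, sum_prob]) (by linarith) (a, b, c)

end Submodularity

lemma mutualInfo_sub_mutualInfo (P : Ω → ℝ) (u : Ω → α) (y : Ω → β) (s : Ω → γ) :
    mutualInfo P u y - mutualInfo P u s =
      entropy P y - entropy P (fun ω => (u ω, y ω)) - entropy P s
        + entropy P (fun ω => (u ω, s ω)) := by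
  simp only [mutualInfo, condEntropy]
  ring

/-- `I(U; Y) - I(U; S) ≤ H(Y | S)`. -/
lemma mutualInfo_sub_mutualInfo_le {P : Ω → ℝ} (hP : ∀ ω, 0 ≤ P ω) (u : Ω → α) (y : Ω → β)
    (s : Ω → γ) : mutualInfo P u y - mutualInfo P u s ≤ condEntropy P y s := by
  rw [mutualInfo_sub_mutualInfo, condEntropy]
  -- The slack consists of `I(U;S|Y)` and `H(Y|U,S)`.
  have h1 := entropy_submodular u y s hP
  have h2 := entropy_le_of_comp hP (fun ω => (u ω, y ω, s ω)) (fun ω => (u ω, s ω))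
    (fun z => (z.1, z.2.2)) fun _ => rfl
  linarith

/-- If `Y` is a function of `(U, S)`, then `I(U; Y) - I(U; S) ≤ I(T; Y) - I(T; S)` for every
function `T` of `U` such that `Y` is a function of `(T, S)`. -/
lemma mutualInfo_sub_mutualInfo_le_comp {P : Ω → ℝ} (hP : ∀ ω, 0 ≤ P ω) {τ : Type} [Fintype τ]
    [DecidableEq τ] (u : Ω → α) (y : Ω → β) (s : Ω → γ) (t : α → τ) (η : τ × γ → β)
    (hy : ∀ ω, y ω = η (t (u ω), s ω)) :
    mutualInfo P u y - mutualInfo P u s ≤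
      mutualInfo P (fun ω => t (u ω)) y - mutualInfo P (fun ω => t (u ω)) s := by
  rw [mutualInfo_sub_mutualInfo, mutualInfo_sub_mutualInfo]
  -- The difference of the two sides is `I(U;S|T,Y)`; the identities below use that `T` is a
  -- function of `U` and `Y` a function of `(T,S)`.
  have h1 := entropy_submodular u (fun ω => (t (u ω), y ω)) s hP
  have h2 : entropy P (fun ω => (u ω, t (u ω), y ω)) = entropy P (fun ω => (u ω, y ω)) :=
    entropy_congr hP _ _ (fun z => (z.1, t z.1, z.2)) (fun z => (z.1, z.2.2)) (fun _ => rfl)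
      fun _ => rfl
  have h3 : entropy P (fun ω => ((t (u ω), y ω), s ω)) = entropy P (fun ω => (t (u ω), s ω)) :=
    entropy_congr hP _ _ (fun z => ((z.1, η z), z.2)) (fun z => (z.1.1, z.2))
      (fun ω => by rw [hy]) fun _ => rfl
  have h4 := entropy_le_of_comp hP (fun ω => (u ω, (t (u ω), y ω), s ω)) (fun ω => (u ω, s ω))
    (fun z => (z.1, z.2.2)) fun _ => rfl
  linarith

lemma continuous_entropy {X : Type} [TopologicalSpace X] {P : X → Ω → ℝ}
    (hP : ∀ ω, Continuous fun x => P x ω) (f : Ω → α) : Continuous fun x => entropy (P x) f := by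
  have hprob : ∀ a, Continuous fun x => prob (P x) f a := fun a =>
    continuous_finsetSum _ fun ω _ => by
      split_ifs
      exacts [hP ω, continuous_const]
  refine continuous_finsetSum _ fun a _ => (Continuous.neg ?_)
  -- The product `v log v` is continuous at 0, although the logarithm is not.
  have : ∀ v : ℝ, v * Real.logb 2 v = v * Real.log v / Real.log 2 := fun v => by
    rw [Real.logb, mul_div_assoc]
  simp only [this]
  exact (Real.continuous_mul_log.comp (hprob a)).div_const _

lemma continuous_mutualInfo {X : Type} [TopologicalSpace X] {P : X → Ω → ℝ}
    (hP : ∀ ω, Continuous fun x => P x ω) (f : Ω → α) (g : Ω → β) :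
    Continuous fun x => mutualInfo (P x) f g :=
  (continuous_entropy hP f).sub
    ((continuous_entropy hP fun ω => (f ω, g ω)).sub (continuous_entropy hP g))

end InformationMeasures

/-! ### The output entropy given the state of a faulty cell. -/

section ConditionalEntropy

variable {Ω Ω' α β γ σ : Type} [Fintype Ω] [Fintype Ω'] [Fintype α] [Fintype β] [Fintype γ]
  [Fintype σ] [DecidableEq Ω'] [DecidableEq α] [DecidableEq β] [DecidableEq γ] [DecidableEq σ]

lemma condEntropy_prob (P : Ω → ℝ) (φ : Ω → Ω') (f : Ω' → α) (g : Ω' → β) :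
    condEntropy (prob P φ) f g = condEntropy P (fun ω => f (φ ω)) fun ω => g (φ ω) := by
  simp only [condEntropy, entropy_prob]

lemma mutualInfo_prob (P : Ω → ℝ) (φ : Ω → Ω') (f : Ω' → α) (g : Ω' → β) :
    mutualInfo (prob P φ) f g = mutualInfo P (fun ω => f (φ ω)) fun ω => g (φ ω) := by
  simp only [mutualInfo, condEntropy, entropy_prob]

lemma condMutualInfo_prob (P : Ω → ℝ) (φ : Ω → Ω') (f : Ω' → α) (g : Ω' → β) (h : Ω' → γ) :
    condMutualInfo (prob P φ) f g h =
      condMutualInfo P (fun ω => f (φ ω)) (fun ω => g (φ ω)) fun ω => h (φ ω) := by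
  simp only [condMutualInfo, condEntropy, entropy_prob]

variable (P : Ω → ℝ) (y : Ω → β) (s : Ω → Option σ) (η : σ → β)

/-- The joint law of `(y, s)` if `y` is uniform in the fault-free state `none` and equal to `η j`
in the state `some j`. -/
def faultyUniformLaw (z : β × Option σ) : ℝ :=
  prob P s z.2 * z.2.elim (1 / Fintype.card β : ℝ) fun j => if z.1 = η j then 1 else 0

lemma faultyUniformLaw_nonneg (hP : ∀ ω, 0 ≤ P ω) (z : β × Option σ) :
    0 ≤ faultyUniformLaw P s η z := by
  refine mul_nonneg (prob_nonneg hP _ _) ?_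
  rcases z with ⟨b, _ | j⟩
  · dsimp only [Option.elim]
    positivity
  · dsimp only [Option.elim]
    split_ifs <;> norm_num

lemma sum_faultyUniformLaw [Nonempty β] : ∑ z, faultyUniformLaw P s η z = ∑ ω, P ω := by
  rw [Fintype.sum_prod_type, Finset.sum_comm, ← sum_prob P s]
  refine Finset.sum_congr rfl fun c _ => ?_
  simp only [faultyUniformLaw, ← Finset.mul_sum]
  rcases c with _ | j <;> simp

variable {P y s η}

lemma prob_fault_eq_zero (hη : ∀ ω j, s ω = some j → y ω = η j) {b : β} {j : σ} (hb : b ≠ η j) :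
    prob P (fun ω => (y ω, s ω)) (b, some j) = 0 := by
  refine Finset.sum_eq_zero fun ω _ => if_neg fun h => hb ?_
  rw [Prod.mk.injEq] at h
  rw [← h.1, hη ω j h.2]

lemma prob_eq_zero_of_faultyUniformLaw [Nonempty β] (hP : ∀ ω, 0 ≤ P ω)
    (hη : ∀ ω j, s ω = some j → y ω = η j) (z : β × Option σ)
    (hz : faultyUniformLaw P s η z = 0) : prob P (fun ω => (y ω, s ω)) z = 0 := by
  have h1 := prob_le_prob_comp hP (fun ω => (y ω, s ω)) (fun z => z.2) z
  have h0 := prob_nonneg hP (fun ω => (y ω, s ω)) z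
  dsimp only at h1
  rcases mul_eq_zero.1 hz with h | h
  · linarith
  · rcases z with ⟨b, _ | j⟩
    · simp at h
    · refine prob_fault_eq_zero hη fun hb => ?_
      simp [hb] at h

/-- The distance of `H(Y|S)` from its maximum is the divergence from `faultyUniformLaw`, so Gibbs
yields the bound, and its equality case yields uniformity in the fault-free state. -/
lemma condEntropy_defect [Nonempty β] (hP : ∀ ω, 0 ≤ P ω)
    (hη : ∀ ω j, s ω = some j → y ω = η j) :
    prob P s none * Real.logb 2 (Fintype.card β) - condEntropy P y s =
      ∑ z : β × Option σ, prob P (fun ω => (y ω, s ω)) z *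
        Real.logb 2 (prob P (fun ω => (y ω, s ω)) z / faultyUniformLaw P s η z) := by
  have e1 := entropy_comp P (fun ω => (y ω, s ω)) fun z => z
  have e2 := entropy_comp P (fun ω => (y ω, s ω)) fun z => z.2
  have e3 : prob P s none = ∑ z, prob P (fun ω => (y ω, s ω)) z * if z.2 = none then 1 else 0 := by
    rw [sum_prob_mul, prob]
    simp
  dsimp only at e1 e2
  rw [condEntropy, e1, e2, e3, Finset.sum_mul, sub_neg_eq_add, neg_add_eq_sub, sub_sub_eq_add_sub,
    ← Finset.sum_add_distrib, ← Finset.sum_sub_distrib]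
  refine Finset.sum_congr rfl fun z _ => ?_
  have h1 := prob_le_prob_comp hP (fun ω => (y ω, s ω)) (fun z => z.2) z
  dsimp only at h1
  rcases (prob_nonneg hP (fun ω => (y ω, s ω)) z).eq_or_lt with h0 | h0
  · simp [← h0]
  have h2 := h0.trans_le h1
  rcases z with ⟨b, _ | j⟩
  · have hc : (0 : ℝ) < Fintype.card β := by exact_mod_cast Fintype.card_pos
    simp only [faultyUniformLaw, Option.elim, if_true, mul_one_div] at h2 ⊢
    rw [Real.logb_div h0.ne' (by positivity), Real.logb_div h2.ne' hc.ne']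
    ring
  · have hb : b = η j := by
      by_contra hb
      exact h0.ne' (prob_fault_eq_zero hη hb)
    simp only [faultyUniformLaw, Option.elim, if_pos hb, mul_one, reduceCtorEq, if_false] at h2 ⊢
    rw [Real.logb_div h0.ne' h2.ne']
    ring

lemma condEntropy_le [Nonempty β] (hP : ∀ ω, 0 ≤ P ω) (hη : ∀ ω j, s ω = some j → y ω = η j) :
    condEntropy P y s ≤ prob P s none * Real.logb 2 (Fintype.card β) := by
  have h1 := condEntropy_defect hP hη
  have h2 := sum_mul_logb_div_nonneg (prob_nonneg hP fun ω => (y ω, s ω))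
    (faultyUniformLaw_nonneg P s η hP) (prob_eq_zero_of_faultyUniformLaw hP hη)
    (by rw [sum_faultyUniformLaw, sum_prob])
  linarith

lemma prob_none_eq_of_le_condEntropy [Nonempty β] (hP : ∀ ω, 0 ≤ P ω)
    (hη : ∀ ω j, s ω = some j → y ω = η j)
    (h : prob P s none * Real.logb 2 (Fintype.card β) ≤ condEntropy P y s) (b : β) :
    prob P (fun ω => (y ω, s ω)) (b, none) = prob P s none * (1 / Fintype.card β) := by
  have h1 := condEntropy_defect hP hη
  exact eq_of_sum_mul_logb_div_nonpos (prob_nonneg hP fun ω => (y ω, s ω))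
    (faultyUniformLaw_nonneg P s η hP) (prob_eq_zero_of_faultyUniformLaw hP hη)
    (by rw [sum_faultyUniformLaw, sum_prob]) (by linarith) (b, none)

end ConditionalEntropy

/-! ### Single-letter outer bounds and the gap of the Gelfand-Pinsker region. -/

section StuckFault

/-- The law of the state of the memory with stuck faults. -/
def faultLaw (p : ℝ) (s : Option (Fin 4)) : ℝ := s.elim (1 - p) fun _ => p / 4

/-- The joint law of `(U, S)`. -/
def inputLaw (p : ℝ) {U : Type} (q : Option (Fin 4) → U → ℝ) (ω : U × Option (Fin 4)) : ℝ :=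
  faultLaw p ω.2 * q ω.2 ω.1

variable {p : ℝ} {U : Type} [Fintype U] [DecidableEq U] {q : Option (Fin 4) → U → ℝ}

lemma faultLaw_nonneg (hp : p ∈ Set.Icc (0 : ℝ) 1) (s : Option (Fin 4)) : 0 ≤ faultLaw p s :=
  (stuckFaultChannel p hp).stateLaw_mem.1 s

lemma inputLaw_nonneg (hp : p ∈ Set.Icc (0 : ℝ) 1) (hq : ∀ s, q s ∈ stdSimplex ℝ U)
    (ω : U × Option (Fin 4)) : 0 ≤ inputLaw p q ω :=
  mul_nonneg (faultLaw_nonneg hp _) ((hq _).1 _)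

lemma prob_state_inputLaw (hq : ∀ s, q s ∈ stdSimplex ℝ U) (s : Option (Fin 4)) :
    prob (inputLaw p q) (fun ω => ω.2) s = faultLaw p s := by
  rw [prob, Fintype.sum_prod_type_right]
  have (s' : Option (Fin 4)) : (∑ u, if s' = s then inputLaw p q (u, s') else 0) =
      if s' = s then faultLaw p s' else 0 := by
    split_ifs
    · simp only [inputLaw, ← Finset.mul_sum, (hq _).2, mul_one]
    · exact Finset.sum_const_zero
  simp [this]

/-- The outputs are functions of `(U,S)`, so every information quantity can be computed on the space
of pairs `(u,s)`. -/
lemma jointLaw_eq_prob (hp : p ∈ Set.Icc (0 : ℝ) 1) (q : Option (Fin 4) → U → ℝ)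
    (f : U → Option (Fin 4) → Fin 4) :
    (stuckFaultChannel p hp).jointLaw q f = prob (inputLaw p q) fun ω =>
      (ω.1, ω.2, stuckOutput (f ω.1 ω.2) ω.2, merge (stuckOutput (f ω.1 ω.2) ω.2)) := by
  funext ⟨u, s, y⟩
  rw [prob, Finset.sum_eq_single (u, s)]
  · simp only [Channel.jointLaw, stuckFaultChannel, inputLaw, faultLaw, Prod.mk.injEq, true_and,
      mul_ite, mul_one, mul_zero]
    exact if_congr eq_comm rfl rfl
  · intro ω _ hω
    refine if_neg fun h => hω ?_
    simp only [Prod.mk.injEq] at h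
    exact Prod.ext h.1 h.2.1
  · simp

lemma logb_card_four : Real.logb 2 (Fintype.card (Fin 4)) = 2 := by
  rw [Fintype.card_fin, show ((4 : ℕ) : ℝ) = 2 ^ (2 : ℕ) by norm_num, Real.logb_pow,
    Real.logb_self_eq_one (by norm_num)]
  norm_num

lemma logb_card_two : Real.logb 2 (Fintype.card (Fin 2)) = 1 := by
  rw [Fintype.card_fin, Nat.cast_ofNat, Real.logb_self_eq_one (by norm_num)]

lemma condEntropy_output_le (hp : p ∈ Set.Icc (0 : ℝ) 1) (hq : ∀ s, q s ∈ stdSimplex ℝ U)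
    (f : U → Option (Fin 4) → Fin 4) :
    condEntropy ((stuckFaultChannel p hp).jointLaw q f) (fun ω => ω.2.2.1) (fun ω => ω.2.1) ≤
        2 - 2 * p ∧
      condEntropy ((stuckFaultChannel p hp).jointLaw q f) (fun ω => ω.2.2.2) (fun ω => ω.2.1) ≤
        1 - p := by
  rw [jointLaw_eq_prob, condEntropy_prob, condEntropy_prob]
  have h1 := condEntropy_le (inputLaw_nonneg hp hq)
    (y := fun ω => stuckOutput (f ω.1 ω.2) ω.2) (s := fun ω => ω.2) (η := fun j => j)
    (fun ω j h => by rw [h]; rfl)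
  have h2 := condEntropy_le (inputLaw_nonneg hp hq)
    (y := fun ω => merge (stuckOutput (f ω.1 ω.2) ω.2)) (s := fun ω => ω.2) (η := merge)
    (fun ω j h => by rw [h]; rfl)
  rw [prob_state_inputLaw hq, logb_card_four] at h1
  rw [prob_state_inputLaw hq, logb_card_two] at h2
  simp only [faultLaw, Option.elim] at h1 h2
  constructor <;> linarith

lemma jointLaw_nonneg (hp : p ∈ Set.Icc (0 : ℝ) 1) (hq : ∀ s, q s ∈ stdSimplex ℝ U)
    (f : U → Option (Fin 4) → Fin 4) (ω) : 0 ≤ (stuckFaultChannel p hp).jointLaw q f ω := by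
  rw [jointLaw_eq_prob]
  exact prob_nonneg (inputLaw_nonneg hp hq) _ _

/-- The rate region of the stuck-fault channel. -/
def stuckFaultRegion (p : ℝ) : Set (Fin 3 → ℝ) :=
  {R | (∀ i, 0 ≤ R i) ∧ R 0 + R 1 ≤ 2 - 2 * p ∧ R 0 + R 2 ≤ 1 - p}

lemma isClosed_stuckFaultRegion (p : ℝ) : IsClosed (stuckFaultRegion p) := by
  simp only [stuckFaultRegion, Set.ofPred_and, Set.ofPred_forall]
  refine (isClosed_iInter fun i => ?_).inter (IsClosed.inter ?_ ?_) <;>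
    exact isClosed_le (by fun_prop) (by fun_prop)

lemma twoLayerRegionOfSize_subset (hp : p ∈ Set.Icc (0 : ℝ) 1) (k₁ k₂ : ℕ) :
    (stuckFaultChannel p hp).twoLayerRegionOfSize k₁ k₂ ⊆ stuckFaultRegion p := by
  rintro R ⟨hR, q, f, hq, -, -, -, h1, h2⟩
  have hP := jointLaw_nonneg hp hq f
  obtain ⟨b1, b2⟩ := condEntropy_output_le hp hq f
  have c1 := mutualInfo_sub_mutualInfo_le hP (fun ω => ω.1) (fun ω => ω.2.2.1) (fun ω => ω.2.1)
  have c2 := mutualInfo_sub_mutualInfo_le hP (fun ω => ω.1.1) (fun ω => ω.2.2.2) (fun ω => ω.2.1)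
  exact ⟨hR, by linarith, by linarith⟩

lemma gelfandPinskerRegion_subset (hp : p ∈ Set.Icc (0 : ℝ) 1) :
    (stuckFaultChannel p hp).gelfandPinskerRegion ⊆ stuckFaultRegion p := by
  rintro R ⟨hR, k, q, f, hq, h1, h2⟩
  have hP := jointLaw_nonneg hp hq f
  obtain ⟨b1, b2⟩ := condEntropy_output_le hp hq f
  have c1 := mutualInfo_sub_mutualInfo_le hP (fun ω => ω.1) (fun ω => ω.2.2.1) (fun ω => ω.2.1)
  have c2 := mutualInfo_sub_mutualInfo_le hP (fun ω => ω.1) (fun ω => ω.2.2.2) (fun ω => ω.2.1)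
  exact ⟨hR, by linarith, by linarith⟩

/-! The Gelfand-Pinsker region is generated by auxiliary variables with values in the input
alphabet: `U` may be replaced by the input chosen in the fault-free state. -/

/-- The Gelfand-Pinsker rates of an auxiliary variable that is the fault-free input. -/
def inputRate {β : Type} [Fintype β] [DecidableEq β] (p : ℝ) (g : Fin 4 → β)
    (q : Option (Fin 4) → Fin 4 → ℝ) : ℝ :=
  mutualInfo (inputLaw p q) (fun ω => ω.1) (fun ω => g (stuckOutput ω.1 ω.2))
    - mutualInfo (inputLaw p q) (fun ω => ω.1) fun ω => ω.2

lemma prob_mem_stdSimplex {α : Type} [Fintype α] [DecidableEq α] {P : U → ℝ}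
    (hP : P ∈ stdSimplex ℝ U) (t : U → α) : prob P t ∈ stdSimplex ℝ α :=
  ⟨prob_nonneg hP.1 t, by rw [sum_prob, hP.2]⟩

lemma inputLaw_prob {α : Type} [Fintype α] [DecidableEq α] (q : Option (Fin 4) → U → ℝ)
    (t : U → α) :
    inputLaw p (fun s => prob (q s) t) = prob (inputLaw p q) fun ω => (t ω.1, ω.2) := by
  funext ⟨a, s⟩
  rw [prob, Fintype.sum_prod_type]
  simp only [inputLaw, prob, Finset.mul_sum, Prod.mk.injEq]
  refine Finset.sum_congr rfl fun u _ => ?_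
  by_cases h : t u = a <;> simp [h]

lemma stuckOutput_eq (f : Option (Fin 4) → Fin 4) (s : Option (Fin 4)) :
    stuckOutput (f s) s = stuckOutput (f none) s := by
  cases s <;> rfl

/-- A stuck cell ignores its input, so the output is a function of `S` and `T = f(U, none)`; hence
passing from `U` to `T` loses nothing. -/
lemma rate_le_inputRate {β : Type} [Fintype β] [DecidableEq β] (hp : p ∈ Set.Icc (0 : ℝ) 1)
    (hq : ∀ s, q s ∈ stdSimplex ℝ U) (f : U → Option (Fin 4) → Fin 4) (g : Fin 4 → β) :
    mutualInfo (inputLaw p q) (fun ω => ω.1) (fun ω => g (stuckOutput (f ω.1 ω.2) ω.2))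
        - mutualInfo (inputLaw p q) (fun ω => ω.1) (fun ω => ω.2) ≤
      inputRate p g fun s => prob (q s) fun u => f u none := by
  have := mutualInfo_sub_mutualInfo_le_comp (inputLaw_nonneg hp hq) (fun ω => ω.1)
    (fun ω => g (stuckOutput (f ω.1 ω.2) ω.2)) (fun ω => ω.2) (fun u => f u none)
    (fun z => g (stuckOutput z.1 z.2)) fun ω => by rw [stuckOutput_eq]
  refine this.trans_eq ?_
  rw [inputRate, inputLaw_prob, mutualInfo_prob, mutualInfo_prob]
  simp only [fun ω : U × Option (Fin 4) => stuckOutput_eq (f ω.1) ω.2]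

lemma exists_inputRate_of_mem_gelfandPinskerRegion (hp : p ∈ Set.Icc (0 : ℝ) 1) {R : Fin 3 → ℝ}
    (hR : R ∈ (stuckFaultChannel p hp).gelfandPinskerRegion) :
    ∃ q : Option (Fin 4) → Fin 4 → ℝ, (∀ s, q s ∈ stdSimplex ℝ (Fin 4)) ∧
      R 0 + R 1 ≤ inputRate p id q ∧ R 0 + R 2 ≤ inputRate p merge q := by
  obtain ⟨-, k, q, f, hq, h1, h2⟩ := hR
  refine ⟨fun s => prob (q s) fun u => f u none, fun s => prob_mem_stdSimplex (hq s) _, ?_, ?_⟩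
  · rw [jointLaw_eq_prob, mutualInfo_prob, mutualInfo_prob] at h1
    exact h1.trans (rate_le_inputRate hp hq f id)
  · rw [jointLaw_eq_prob, mutualInfo_prob, mutualInfo_prob] at h2
    exact h2.trans (rate_le_inputRate hp hq f merge)

lemma continuous_inputRate {β : Type} [Fintype β] [DecidableEq β] (p : ℝ) (g : Fin 4 → β) :
    Continuous (inputRate p g) := by
  have : ∀ ω, Continuous fun q : Option (Fin 4) → Fin 4 → ℝ => inputLaw p q ω := fun ω => by
    unfold inputLaw
    fun_prop
  exact (continuous_mutualInfo this _ _).sub (continuous_mutualInfo this _ _)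

/-- If the rate equals its upper bound `H(Y | S)`, then `U` and `S` are independent given `Y`. -/
lemma tight_of_le_inputRate {β : Type} [Fintype β] [DecidableEq β] [Nonempty β]
    (hp : p ∈ Set.Icc (0 : ℝ) 1) {q : Option (Fin 4) → Fin 4 → ℝ}
    (hq : ∀ s, q s ∈ stdSimplex ℝ (Fin 4)) (g : Fin 4 → β)
    (h : (1 - p) * Real.logb 2 (Fintype.card β) ≤ inputRate p g q) :
    (∀ b, prob (inputLaw p q) (fun ω => (g (stuckOutput ω.1 ω.2), ω.2)) (b, none) =
        (1 - p) * (1 / Fintype.card β)) ∧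
      ∀ a b c, prob (inputLaw p q) (fun ω => (ω.1, g (stuckOutput ω.1 ω.2), ω.2)) (a, b, c) =
        prob (inputLaw p q) (fun ω => (ω.1, g (stuckOutput ω.1 ω.2))) (a, b) *
          prob (inputLaw p q) (fun ω => (g (stuckOutput ω.1 ω.2), ω.2)) (b, c) /
          prob (inputLaw p q) (fun ω => g (stuckOutput ω.1 ω.2)) b := by
  have hP := inputLaw_nonneg hp hq
  have hη : ∀ (ω : Fin 4 × Option (Fin 4)) j, ω.2 = some j → g (stuckOutput ω.1 ω.2) = g j :=
    fun ω j h => by rw [h]; rfl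
  -- The hypothesis closes the chain `I(U;Y) - I(U;S) ≤ H(Y|S) ≤ (1-p) log |β|`, so each link is an
  -- equality.
  rw [inputRate, mutualInfo_sub_mutualInfo] at h
  have h1 := condEntropy_le hP (y := fun ω => g (stuckOutput ω.1 ω.2)) (s := fun ω => ω.2) hη
  have h2 := entropy_submodular (fun ω => ω.1) (fun ω => g (stuckOutput ω.1 ω.2))
    (fun ω => ω.2) hP
  have h3 := entropy_le_of_comp hP (fun ω => (ω.1, g (stuckOutput ω.1 ω.2), ω.2))
    (fun ω => (ω.1, ω.2)) (fun z => (z.1, z.2.2)) fun _ => rfl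
  have hs : prob (inputLaw p q) (fun ω => ω.2) none = 1 - p := prob_state_inputLaw hq none
  constructor
  · intro b
    rw [← hs]
    refine prob_none_eq_of_le_condEntropy hP hη ?_ b
    rw [hs]
    rw [condEntropy]
    linarith
  · refine prob_eq_of_entropy_le _ _ _ hP ?_
    rw [condEntropy, hs] at h1
    linarith

lemma inputRate_lt_or_lt (hp0 : 0 < p) (hp1 : p < 1) {q : Option (Fin 4) → Fin 4 → ℝ}
    (hq : ∀ s, q s ∈ stdSimplex ℝ (Fin 4)) :
    inputRate p id q < 2 - 2 * p ∨ inputRate p merge q < 1 - p := by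
  by_contra! h
  obtain ⟨hu, hi⟩ := tight_of_le_inputRate ⟨hp0.le, hp1.le⟩ hq id
    (by rw [logb_card_four]; linarith)
  obtain ⟨-, hj⟩ := tight_of_le_inputRate ⟨hp0.le, hp1.le⟩ hq merge
    (by rw [logb_card_two]; linarith)
  have hu0 := hu 0
  have hu1 := hu 1
  -- `U` is the second symbol and the cell is stuck at the first: the two symbols differ for
  -- receiver 1 and are merged for receiver 2.
  have hi := hi 1 0 (some 0)
  have hj := hj 1 0 (some 0)
  have hs : ∀ s, q s 0 + q s 1 + q s 2 + q s 3 = 1 := fun s => by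
    rw [← (hq s).2, Fin.sum_univ_four]
  have hn : ∀ s a, 0 ≤ q s a := fun s => (hq s).1
  simp [prob, Fintype.sum_prod_type, Fintype.sum_option, Fin.sum_univ_four, stuckOutput,
    inputLaw, faultLaw, merge] at hu0 hu1 hi hj
  have hp' : (1 : ℝ) - p ≠ 0 := by linarith
  simp only [hp', or_false] at hu0 hu1
  have e (s : Option (Fin 4)) : p / 4 * q s 0 + p / 4 * q s 1 + p / 4 * q s 2 + p / 4 * q s 3 =
      p / 4 := by linear_combination p / 4 * hs s
  have e' : (1 - p) * q none 0 + p / 4 * q (some 0) 0 + p / 4 * q (some 0) 1 +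
      p / 4 * q (some 0) 2 + p / 4 * q (some 0) 3 = 1 / 4 := by
    linear_combination p / 4 * hs (some 0) + (1 - p) * hu0
  rw [e, e'] at hi
  -- The event `U = 1`, `Y₁ = 0` forces `S = some 0`, whereas `P(S = some 0 | Y₁ = 0) = p < 1`;
  -- independence given `Y₁` thus makes the event null.
  have hx : q (some 0) 1 = 0 := by
    have : p * (1 - p) * q (some 0) 1 = 0 := by linear_combination 4 * hi
    simpa [hp0.ne', hp'] using this
  rw [e, hx, hu0, hu1, mul_zero, zero_add] at hj
  have h0 := hn (some 0)
  have h1 := hn (some 1)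
  -- `U = 1`, `Y₂ = 0` has positive probability, already from the fault-free state; independence
  -- given `Y₂` would then make the event just found null positive.
  have hpos : 0 < (1 - p) * 4⁻¹ + p / 4 * q (some 1) 1 := by
    have := mul_nonneg hp0.le (h1 1)
    linarith
  refine hj.not_lt (div_pos (mul_pos hpos (by linarith)) ?_)
  have := mul_nonneg hp0.le (h0 0)
  have := mul_nonneg hp0.le (h0 2)
  have := mul_nonneg hp0.le (h0 3)
  have := mul_nonneg hp0.le (h1 0)
  have := mul_nonneg hp0.le (h1 2)
  have := mul_nonneg hp0.le (h1 3)
  linarith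

/-- The larger of the two shortfalls is continuous and positive on a compact set of conditional
laws, so its minimum serves as `δ`. -/
lemma exists_gelfandPinskerRegion_gap (hp0 : 0 < p) (hp1 : p < 1) :
    ∃ δ > 0, ∀ R ∈ (stuckFaultChannel p ⟨hp0.le, hp1.le⟩).gelfandPinskerRegion,
      R 0 + R 1 ≤ 2 - 2 * p - δ ∨ R 0 + R 2 ≤ 1 - p - δ := by
  set K : Set (Option (Fin 4) → Fin 4 → ℝ) := Set.univ.pi fun _ => stdSimplex ℝ (Fin 4)
  have hK : IsCompact K := isCompact_univ_pi fun _ => isCompact_stdSimplex ℝ (Fin 4)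
  have hne : K.Nonempty := ⟨fun _ => Pi.single 0 1, fun _ _ => single_mem_stdSimplex ℝ 0⟩
  obtain ⟨q, hq, hmin⟩ := hK.exists_isMinOn hne
    (f := fun q => max (2 - 2 * p - inputRate p id q) (1 - p - inputRate p merge q))
    ((continuous_const.sub (continuous_inputRate p id)).max
      (continuous_const.sub (continuous_inputRate p merge))).continuousOn
  refine ⟨max (2 - 2 * p - inputRate p id q) (1 - p - inputRate p merge q), ?_,
    fun R hR => ?_⟩
  · rcases inputRate_lt_or_lt hp0 hp1 fun s => hq s (Set.mem_univ s) with h | h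
    · exact lt_max_of_lt_left (sub_pos.2 h)
    · exact lt_max_of_lt_right (sub_pos.2 h)
  · obtain ⟨q', hq', h1, h2⟩ := exists_inputRate_of_mem_gelfandPinskerRegion _ hR
    have := isMinOn_iff.1 hmin q' fun s _ => hq' s
    rcases le_max_iff.1 this with h | h
    · left; linarith
    · right; linarith

lemma closure_gelfandPinskerRegion_ssubset (hp0 : 0 < p) (hp1 : p < 1) :
    closure (stuckFaultChannel p ⟨hp0.le, hp1.le⟩).gelfandPinskerRegion ⊂ stuckFaultRegion p := by
  refine Set.ssubset_iff_subset_ne.2 ⟨closure_minimal (gelfandPinskerRegion_subset _)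
    (isClosed_stuckFaultRegion p), fun h => ?_⟩
  obtain ⟨δ, hδ, hgap⟩ := exists_gelfandPinskerRegion_gap hp0 hp1
  -- This corner meets both bounds with equality, so it violates both alternatives of the gap.
  have hmem : ![0, 2 - 2 * p, 1 - p] ∈ stuckFaultRegion p := by
    refine ⟨fun i => ?_, by simp, by simp⟩
    fin_cases i <;> simp <;> linarith
  have hclosed : IsClosed {R : Fin 3 → ℝ | R 0 + R 1 ≤ 2 - 2 * p - δ ∨ R 0 + R 2 ≤ 1 - p - δ} := by
    rw [Set.ofPred_or]
    exact (isClosed_le (by fun_prop) (by fun_prop)).union (isClosed_le (by fun_prop) (by fun_prop))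
  rw [← h] at hmem
  have := closure_minimal hgap hclosed hmem
  rcases this with h | h <;> simp at h <;> linarith

end StuckFault

/-! The two layers of a symbol are its merged bit and its parity. -/

/-- The parity of a symbol, the bit that the second receiver does not see. -/
def parity (y : Fin 4) : Fin 2 := if y.val % 2 = 0 then 0 else 1

/-- The symbol with given merged bit and parity. -/
def ofBits (a b : Fin 2) : Fin 4 := finProdFinEquiv (a, b)

lemma merge_ofBits : ∀ a b, merge (ofBits a b) = a := by decide

lemma parity_ofBits : ∀ a b, parity (ofBits a b) = b := by decide

lemma ofBits_merge_parity : ∀ y, ofBits (merge y) (parity y) = y := by decide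

lemma ofBits_eq_iff {a b : Fin 2} {y : Fin 4} : ofBits a b = y ↔ (merge y, parity y) = (a, b) := by
  constructor
  · rintro rfl
    rw [merge_ofBits, parity_ofBits]
  · rintro h
    rw [Prod.mk.injEq] at h
    rw [← h.1, ← h.2, ofBits_merge_parity]

/-! ### Binary auxiliary variables that attain both bounds. -/

section Uniform

variable {p : ℝ}

/-- The law of `(X, S)` for an input that is uniform and independent of the state. -/
def uniformLaw (p : ℝ) : Fin 4 × Option (Fin 4) → ℝ := inputLaw p fun _ _ => 1 / 4

/-- The conditional law of the two bits of the memory cell. -/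
def bitsLaw (s : Option (Fin 4)) (v : Fin 2 × Fin 2) : ℝ :=
  s.elim (1 / 4) fun j => if (merge j, parity j) = v then 1 else 0

lemma bitsLaw_mem (s : Option (Fin 4)) : bitsLaw s ∈ stdSimplex ℝ (Fin 2 × Fin 2) := by
  refine ⟨fun v => ?_, ?_⟩
  · rcases s with _ | j
    · norm_num [bitsLaw]
    · simp only [bitsLaw, Option.elim]
      split_ifs <;> norm_num
  · rcases s with _ | j <;> simp [bitsLaw]

lemma inputLaw_bitsLaw : inputLaw p bitsLaw = prob (uniformLaw p) fun ω =>
    ((merge (stuckOutput ω.1 ω.2), parity (stuckOutput ω.1 ω.2)), ω.2) := by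
  funext ⟨⟨a, b⟩, s⟩
  rw [prob, Fintype.sum_prod_type_right, Finset.sum_eq_single s]
  · rcases s with _ | j
    · simp only [stuckOutput, Option.getD, Prod.mk.injEq (_, _), and_true,
        ← ofBits_eq_iff (a := a) (b := b)]
      simp [inputLaw, bitsLaw, uniformLaw]
    · simp [stuckOutput, inputLaw, bitsLaw, uniformLaw]
      split_ifs <;> ring
  · intro s' _ hs
    refine Finset.sum_eq_zero fun x _ => if_neg fun h => hs ?_
    exact congrArg Prod.snd h
  · simp

lemma jointLaw_bitsLaw (hp : p ∈ Set.Icc (0 : ℝ) 1) :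
    (stuckFaultChannel p hp).jointLaw bitsLaw (fun v _ => ofBits v.1 v.2) =
      prob (uniformLaw p) fun ω =>
        ((merge (stuckOutput ω.1 ω.2), parity (stuckOutput ω.1 ω.2)), ω.2, stuckOutput ω.1 ω.2,
          merge (stuckOutput ω.1 ω.2)) := by
  rw [jointLaw_eq_prob, inputLaw_bitsLaw]
  funext z
  -- Writing a cell's final content back into it changes nothing, so an input chosen from `V` alone
  -- produces exactly that content.
  have h (ω : Fin 4 × Option (Fin 4)) :
      stuckOutput (stuckOutput ω.1 ω.2) ω.2 = stuckOutput ω.1 ω.2 := by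
    rcases ω with ⟨x, _ | j⟩ <;> rfl
  rw [prob_prob]
  simp only [ofBits_merge_parity, h]

lemma uniformLaw_nonneg (hp : p ∈ Set.Icc (0 : ℝ) 1) (ω) : 0 ≤ uniformLaw p ω :=
  mul_nonneg (faultLaw_nonneg hp _) (by norm_num)

/-- The content is uniform on four symbols in the fault-free state and constant in every other
state. -/
lemma condEntropy_uniformLaw (hp1 : p < 1) :
    condEntropy (uniformLaw p) (fun ω => stuckOutput ω.1 ω.2) (fun ω => ω.2) = 2 - 2 * p := by
  have hl : Real.logb 2 ((1 - p) * 4⁻¹) = Real.logb 2 (1 - p) - 2 := by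
    have h4 := logb_card_four
    rw [Fintype.card_fin, Nat.cast_ofNat] at h4
    rw [Real.logb_mul (by linarith) (by norm_num), Real.logb_inv, h4]
    ring
  have e1 : p / 4 * 4⁻¹ + p / 4 * 4⁻¹ + p / 4 * 4⁻¹ + p / 4 * 4⁻¹ = p / 4 := by ring
  have e2 : 4 * (p / 4 * 4⁻¹) = p / 4 := by ring
  have e3 : 4 * ((1 - p) * 4⁻¹) = 1 - p := by ring
  simp [condEntropy, entropy, prob, Fintype.sum_prod_type, Fintype.sum_option, Fin.sum_univ_four,
    stuckOutput, uniformLaw, inputLaw, faultLaw, hl, e1, e2, e3]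
  ring

lemma condEntropy_merge_uniformLaw (hp1 : p < 1) :
    condEntropy (uniformLaw p) (fun ω => merge (stuckOutput ω.1 ω.2)) (fun ω => ω.2) = 1 - p := by
  have hl : Real.logb 2 ((1 - p) * 2⁻¹) = Real.logb 2 (1 - p) - 1 := by
    rw [Real.logb_mul (by linarith) (by norm_num), Real.logb_inv,
      Real.logb_self_eq_one (by norm_num)]
    ring
  have e1 : p / 4 * 4⁻¹ + p / 4 * 4⁻¹ + p / 4 * 4⁻¹ + p / 4 * 4⁻¹ = p / 4 := by ring
  have e2 : 4 * (p / 4 * 4⁻¹) = p / 4 := by ring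
  have e3 : 4 * ((1 - p) * 4⁻¹) = 1 - p := by ring
  have e4 : (1 - p) * 4⁻¹ + (1 - p) * 4⁻¹ = (1 - p) * 2⁻¹ := by ring
  simp [condEntropy, entropy, prob, Fintype.sum_prod_type, Fintype.sum_option, Fin.sum_univ_four,
    stuckOutput, uniformLaw, inputLaw, faultLaw, merge, hl, e1, e2, e3, e4]
  ring

lemma stuckFaultRegion_subset (hp : p ∈ Set.Icc (0 : ℝ) 1) (hp1 : p < 1) :
    stuckFaultRegion p ⊆ (stuckFaultChannel p hp).twoLayerRegionOfSize 2 2 := by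
  rintro R ⟨hR, h1, h2⟩
  have hP := uniformLaw_nonneg hp
  have c1 := condEntropy_uniformLaw hp1
  have c2 := condEntropy_merge_uniformLaw hp1
  have e1 : entropy (uniformLaw p) (fun ω => ((merge (stuckOutput ω.1 ω.2),
      parity (stuckOutput ω.1 ω.2)), stuckOutput ω.1 ω.2)) =
      entropy (uniformLaw p) fun ω => stuckOutput ω.1 ω.2 :=
    entropy_congr hP _ _ (fun y => ((merge y, parity y), y)) (fun z => z.2) (fun _ => rfl)
      fun _ => rfl
  have e2 : entropy (uniformLaw p) (fun ω => ((merge (stuckOutput ω.1 ω.2),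
      parity (stuckOutput ω.1 ω.2)), ω.2)) =
      entropy (uniformLaw p) fun ω => (stuckOutput ω.1 ω.2, ω.2) :=
    entropy_congr hP _ _ (fun y => ((merge y.1, parity y.1), y.2))
      (fun z => (ofBits z.1.1 z.1.2, z.2)) (fun _ => rfl)
      fun _ => by rw [ofBits_merge_parity]
  have e3 : entropy (uniformLaw p) (fun ω => (merge (stuckOutput ω.1 ω.2),
      stuckOutput ω.1 ω.2)) = entropy (uniformLaw p) fun ω => stuckOutput ω.1 ω.2 :=
    entropy_congr hP _ _ (fun y => (merge y, y)) (fun z => z.2) (fun _ => rfl) fun _ => rfl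
  have e4 : entropy (uniformLaw p) (fun ω => (merge (stuckOutput ω.1 ω.2),
      merge (stuckOutput ω.1 ω.2))) = entropy (uniformLaw p) fun ω => merge (stuckOutput ω.1 ω.2) :=
    entropy_congr hP _ _ (fun y => (y, y)) (fun z => z.2) (fun _ => rfl) fun _ => rfl
  have e5 : entropy (uniformLaw p) (fun ω => (parity (stuckOutput ω.1 ω.2),
      stuckOutput ω.1 ω.2, merge (stuckOutput ω.1 ω.2))) =
      entropy (uniformLaw p) fun ω => stuckOutput ω.1 ω.2 :=
    entropy_congr hP _ _ (fun y => (parity y, y, merge y)) (fun z => z.2.1) (fun _ => rfl)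
      fun _ => rfl
  have e6 : entropy (uniformLaw p) (fun ω => (stuckOutput ω.1 ω.2,
      merge (stuckOutput ω.1 ω.2))) =
      entropy (uniformLaw p) fun ω => stuckOutput ω.1 ω.2 :=
    entropy_congr hP _ _ (fun y => (y, merge y)) (fun z => z.1) (fun _ => rfl)
      fun _ => rfl
  have e7 : entropy (uniformLaw p) (fun ω => (parity (stuckOutput ω.1 ω.2),
      ω.2, merge (stuckOutput ω.1 ω.2))) =
      entropy (uniformLaw p) fun ω => (stuckOutput ω.1 ω.2, ω.2) :=
    entropy_congr hP _ _ (fun y => (parity y.1, y.2, merge y.1))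
      (fun z => (ofBits z.2.2 z.1, z.2.1)) (fun _ => rfl) fun _ => by rw [ofBits_merge_parity]
  have e8 : entropy (uniformLaw p) (fun ω => (ω.2, merge (stuckOutput ω.1 ω.2))) =
      entropy (uniformLaw p) fun ω => (merge (stuckOutput ω.1 ω.2), ω.2) :=
    entropy_congr hP _ _ (fun y => (y.2, y.1)) (fun y => (y.2, y.1)) (fun _ => rfl) fun _ => rfl
  rw [condEntropy] at c1 c2
  refine ⟨hR, bitsLaw, fun v _ => ofBits v.1 v.2, bitsLaw_mem, ?_, ?_, ?_, ?_, ?_⟩ <;>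
    simp only [jointLaw_bitsLaw, mutualInfo_prob, condMutualInfo_prob]
  -- Each of the three strict inequalities has slack `1 - p`: here `H(Y₁|S) - H(Y₂|S)`, and
  -- `H(Y₂|S)` in the next two.
  · rw [condMutualInfo, condMutualInfo, condEntropy, condEntropy, condEntropy, e5, e6, e7, e8]
    linarith
  · rw [gt_iff_lt, ← sub_pos, mutualInfo_sub_mutualInfo, e3]
    linarith
  · rw [gt_iff_lt, ← sub_pos, mutualInfo_sub_mutualInfo, e4]
    linarith
  · rw [mutualInfo_sub_mutualInfo, e1, e2]
    linarith
  · rw [mutualInfo_sub_mutualInfo, e4]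
    linarith

end Uniform

/-! ### The exponent shared by the converse and the coding theorem. -/

section Exponent

/-- The function of `t` equals 1 at 0, and its derivative there is the left side of `h`. For the
converse `c` is the alphabet size and `d` is `2` to minus the rate; for the coding theorem `c = 1/2`
and `d` is `2` to the rate. -/
lemma exists_rpow_lt_one {p c d : ℝ} (hc : 0 < c) (hd : 0 < d)
    (h : (1 - p) * Real.log c + Real.log d < 0) :
    ∃ t : ℝ, 0 < t ∧ t ≤ 1 ∧ (p + (1 - p) * c ^ t) * d ^ t < 1 := by
  have h1 : HasDerivAt (fun t : ℝ => (p + (1 - p) * c ^ t) * d ^ t)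
      ((1 - p) * Real.log c + Real.log d) 0 := by
    have e1 := Real.hasStrictDerivAt_const_rpow hc 0
    have e2 := Real.hasStrictDerivAt_const_rpow hd 0
    refine (((e1.hasDerivAt.const_mul (1 - p)).const_add p).mul e2.hasDerivAt).congr_deriv ?_
    simp
  have h2 := (hasDerivAt_iff_tendsto_slope.1 h1).eventually_lt_const h
  have h3 : ∀ᶠ t : ℝ in 𝓝[>] 0, slope (fun t : ℝ => (p + (1 - p) * c ^ t) * d ^ t) 0 t < 0 :=
    h2.filter_mono (nhdsWithin_mono _ fun t ht => (Set.mem_Ioi.1 ht).ne')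
  have h4 : ∀ᶠ t : ℝ in 𝓝[>] 0, t ∈ Set.Ioc (0 : ℝ) 1 := Ioc_mem_nhdsGT one_pos
  obtain ⟨t, ht, ht0, ht1⟩ := (h3.and h4).exists
  refine ⟨t, ht0, ht1, ?_⟩
  rw [slope_def_field, sub_zero] at ht
  have h5 := mul_neg_of_neg_of_pos ht ht0
  rw [div_mul_cancel₀ _ ht0.ne'] at h5
  simpa using h5

/-- Interpolates between the trivial bound 1 and a counting bound `u`, so that only a fractional
moment of `u` is needed. -/
lemma le_rpow_of_le {x u t : ℝ} (hx : 0 ≤ x) (hx1 : x ≤ 1) (hxu : x ≤ u) (ht : 0 < t)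
    (ht1 : t ≤ 1) : x ≤ u ^ t := by
  refine le_trans ?_ (Real.rpow_le_rpow hx hxu ht.le)
  rcases hx.eq_or_lt with h | h
  · rw [← h]
    exact Real.rpow_nonneg le_rfl t
  · simpa using Real.rpow_le_rpow_of_exponent_ge h hx1 ht1

end Exponent

/-! ### Moments of the number of words that agree with the stuck cells. -/

section FaultSequences

variable {n : ℕ} {p : ℝ} {β : Type} [Fintype β] [DecidableEq β]

/-- The probability of a state sequence. -/
def faultProb (p : ℝ) (s : Fin n → Option (Fin 4)) : ℝ := ∏ i, faultLaw p (s i)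

lemma faultProb_nonneg (hp : p ∈ Set.Icc (0 : ℝ) 1) (s : Fin n → Option (Fin 4)) :
    0 ≤ faultProb p s := Finset.prod_nonneg fun _ _ => faultLaw_nonneg hp _

/-- The words that agree with the stuck cells after the symbols are relabelled by `π`. -/
def consistentWords (π : Fin 4 → β) (s : Fin n → Option (Fin 4)) : Finset (Fin n → β) :=
  Fintype.piFinset fun i => (s i).elim Finset.univ fun j => {π j}

lemma mem_consistentWords {π : Fin 4 → β} {s : Fin n → Option (Fin 4)} {w : Fin n → β} :
    w ∈ consistentWords π s ↔ ∀ i j, s i = some j → w i = π j := by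
  rw [consistentWords, Fintype.mem_piFinset]
  refine forall_congr' fun i => ?_
  cases h : s i <;> simp

lemma stuckOutput_mem_consistentWords (π : Fin 4 → β) (x : Fin n → Fin 4)
    (s : Fin n → Option (Fin 4)) : (fun i => π (stuckOutput (x i) (s i))) ∈ consistentWords π s :=
  mem_consistentWords.2 fun i j h => by rw [h]; rfl

lemma card_consistentWords (π : Fin 4 → β) (s : Fin n → Option (Fin 4)) :
    ((consistentWords π s).card : ℝ) = ∏ i, (s i).elim (Fintype.card β : ℝ) fun _ => 1 := by
  rw [consistentWords, Fintype.card_piFinset, Nat.cast_prod]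
  refine Finset.prod_congr rfl fun i _ => ?_
  cases s i <;> simp

lemma card_consistentWords_pos [Nonempty β] (π : Fin 4 → β) (s : Fin n → Option (Fin 4)) :
    (0 : ℝ) < (consistentWords π s).card := by
  rw [card_consistentWords]
  refine Finset.prod_pos fun i _ => ?_
  cases s i
  · exact Nat.cast_pos.2 Fintype.card_pos
  · exact one_pos

/-- The count is a product over independent cells, with factor `|β|` for a working cell and 1 for a
stuck one. The converse takes a positive exponent, binning a negative one. -/
lemma sum_faultProb_mul_card_rpow (π : Fin 4 → β) (t : ℝ) :
    ∑ s : Fin n → Option (Fin 4), faultProb p s * ((consistentWords π s).card : ℝ) ^ t =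
      (p + (1 - p) * (Fintype.card β : ℝ) ^ t) ^ n := by
  have h (s : Fin n → Option (Fin 4)) :
      faultProb p s * ((consistentWords π s).card : ℝ) ^ t =
        ∏ i, faultLaw p (s i) * ((s i).elim (Fintype.card β : ℝ) fun _ => 1) ^ t := by
    rw [card_consistentWords, faultProb, ← Real.finsetProd_rpow, Finset.prod_mul_distrib]
    intro i _
    cases s i <;> simp
  simp_rw [h]
  rw [← Fintype.piFinset_univ, ← Finset.prod_univ_sum
    (f := fun _ s => faultLaw p s * (s.elim (Fintype.card β : ℝ) fun _ => 1) ^ t)]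
  rw [Finset.prod_const, Finset.card_univ, Fintype.card_fin, Fintype.sum_option]
  simp [faultLaw]
  ring

lemma sum_faultProb : ∑ s : Fin n → Option (Fin 4), faultProb p s = 1 := by
  have := sum_faultProb_mul_card_rpow (n := n) (p := p) (id : Fin 4 → Fin 4) 0
  simpa using this

end FaultSequences

/-! ### The error probability for deterministic outputs. -/

section Error

variable {n M₀ M₁ M₂ : ℕ} {p : ℝ}

/-- The content of the memory cells when the message `m` is stored. -/
def cellContent (c : Code (Fin 4) (Option (Fin 4)) (Fin 4) (Fin 2) n M₀ M₁ M₂)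
    (m : Fin M₀ × Fin M₁ × Fin M₂) (s : Fin n → Option (Fin 4)) (i : Fin n) : Fin 4 :=
  stuckOutput (c.enc m s i) (s i)

/-- Both receivers decode correctly. -/
def Correct (c : Code (Fin 4) (Option (Fin 4)) (Fin 4) (Fin 2) n M₀ M₁ M₂)
    (m : Fin M₀ × Fin M₁ × Fin M₂) (s : Fin n → Option (Fin 4)) : Prop :=
  c.dec₁ (cellContent c m s) m.2.2 = (m.1, m.2.1) ∧
    c.dec₂ (fun i => merge (cellContent c m s i)) m.2.1 = (m.1, m.2.2)

open scoped Classical in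
lemma errorProb_eq (hp : p ∈ Set.Icc (0 : ℝ) 1)
    (c : Code (Fin 4) (Option (Fin 4)) (Fin 4) (Fin 2) n M₀ M₁ M₂) :
    (stuckFaultChannel p hp).errorProb c =
      (∑ m, ∑ s, if Correct c m s then 0 else faultProb p s) / ((M₀ : ℝ) * M₁ * M₂) := by
  rw [Channel.errorProb]
  congr 1
  refine Finset.sum_congr rfl fun m _ => Finset.sum_congr rfl fun s _ => ?_
  rw [Finset.sum_eq_single fun i => (cellContent c m s i, merge (cellContent c m s i))]
  · have h : ∏ i, (stuckFaultChannel p hp).trans (c.enc m s i) (s i)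
        (cellContent c m s i, merge (cellContent c m s i)) = 1 :=
      Finset.prod_eq_one fun i _ => if_pos rfl
    rw [h, mul_one, ← ite_not]
    refine if_congr ?_ rfl rfl
    rw [not_or, not_not, not_not]
    rfl
  · intro y _ hy
    obtain ⟨i, hi⟩ := Function.ne_iff.1 hy
    have h : ∏ i, (stuckFaultChannel p hp).trans (c.enc m s i) (s i) (y i) = 0 :=
      Finset.prod_eq_zero (Finset.mem_univ i) (if_neg hi)
    rw [h, mul_zero, ite_self]
  · simp

open scoped Classical in
lemma one_sub_errorProb (hp : p ∈ Set.Icc (0 : ℝ) 1) (h₀ : 0 < M₀) (h₁ : 0 < M₁) (h₂ : 0 < M₂)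
    (c : Code (Fin 4) (Option (Fin 4)) (Fin 4) (Fin 2) n M₀ M₁ M₂) :
    1 - (stuckFaultChannel p hp).errorProb c =
      (∑ m, ∑ s, if Correct c m s then faultProb p s else 0) /
        Fintype.card (Fin M₀ × Fin M₁ × Fin M₂) := by
  have h : ∑ m, ∑ s, (if Correct c m s then faultProb p s else 0) =
      Fintype.card (Fin M₀ × Fin M₁ × Fin M₂) -
        ∑ m, ∑ s, if Correct c m s then 0 else faultProb p s := by
    rw [eq_sub_iff_add_eq, ← Finset.sum_add_distrib]
    simp_rw [← Finset.sum_add_distrib]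
    have (m : Fin M₀ × Fin M₁ × Fin M₂) : ∑ s, ((if Correct c m s then faultProb p s else 0) +
        if Correct c m s then 0 else faultProb p s) = 1 := by
      rw [← sum_faultProb (n := n) (p := p)]
      exact Finset.sum_congr rfl fun s _ => by split_ifs <;> simp
    simp [this]
  have h3 : (0 : ℝ) < (M₀ : ℝ) * M₁ * M₂ := by positivity
  rw [h, errorProb_eq, Fintype.card_prod, Fintype.card_prod, Fintype.card_fin, Fintype.card_fin,
    Fintype.card_fin]
  push_cast
  rw [← mul_assoc, sub_div, div_self h3.ne']

end Error

/-! ### Strong converse by counting. -/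

section Converse

variable {n : ℕ} {p : ℝ}

open scoped Classical in
/-- The strong converse for a receiver with side information `side` that observes words agreeing
with the stuck cells. -/
lemma success_le {𝓜 κ β : Type} [Fintype 𝓜] [Nonempty 𝓜] [Fintype κ] [Fintype β]
    (hp : p ∈ Set.Icc (0 : ℝ) 1) (π : Fin 4 → β)
    (good : 𝓜 → (Fin n → Option (Fin 4)) → Prop)
    (word : 𝓜 → (Fin n → Option (Fin 4)) → Fin n → β) (side : 𝓜 → κ)
    (hword : ∀ m s, word m s ∈ consistentWords π s)
    (hinj : ∀ m m' s, good m s → good m' s → word m s = word m' s → side m = side m' → m = m')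
    {t : ℝ} (ht : 0 < t) (ht1 : t ≤ 1) :
    (∑ m, ∑ s, if good m s then faultProb p s else 0) / Fintype.card 𝓜 ≤
      (p + (1 - p) * (Fintype.card β : ℝ) ^ t) ^ n *
        ((Fintype.card κ : ℝ) / Fintype.card 𝓜) ^ t := by
  have hM : (0 : ℝ) < Fintype.card 𝓜 := by exact_mod_cast Fintype.card_pos
  rw [Finset.sum_comm, Finset.sum_div, ← sum_faultProb_mul_card_rpow π, Finset.sum_mul]
  refine Finset.sum_le_sum fun s _ => ?_
  rw [← Finset.sum_filter, Finset.sum_const, nsmul_eq_mul, mul_comm, mul_div_assoc, mul_assoc,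
    ← Real.mul_rpow (by positivity) (by positivity)]
  refine mul_le_mul_of_nonneg_left ?_ (faultProb_nonneg hp s)
  refine le_rpow_of_le (by positivity) ?_ ?_ ht ht1
  · rw [div_le_one hM]
    exact_mod_cast Finset.card_le_univ _
  · rw [← mul_div_assoc]
    gcongr
    -- For a fixed state sequence, a correctly decoded message is determined by the received word
    -- and the side information.
    have : (Finset.univ.filter fun m => good m s).card ≤
        (consistentWords π s ×ˢ (Finset.univ : Finset κ)).card := by
      refine Finset.card_le_card_of_injOn (fun m => (word m s, side m)) (fun m _ => ?_) ?_
      · simp [hword]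
      · intro m hm m' hm' h
        simp only [Finset.coe_filter, Finset.mem_univ, true_and, Set.mem_ofPred_eq] at hm hm'
        rw [Prod.mk.injEq] at h
        exact hinj m m' s hm hm' h.1 h.2
    rw [Finset.card_product, Finset.card_univ] at this
    exact_mod_cast this

lemma not_tendsto_of_one_sub_le {e : ℕ → ℝ} {θ : ℝ} (h0 : 0 ≤ θ) (h1 : θ < 1)
    (h : ∀ n, 1 - e n ≤ θ ^ n) : ¬ Tendsto e atTop (𝓝 0) := fun he => by
  have := le_of_tendsto_of_tendsto' (tendsto_const_nhds.sub he)
    (tendsto_pow_atTop_nhds_zero_of_lt_one h0 h1) h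
  norm_num at this

lemma inv_mul_inv_rpow_le {n M N : ℕ} {a b t : ℝ} (ht : 0 < t) (hM : (2 : ℝ) ^ (n * a) ≤ M)
    (hN : (2 : ℝ) ^ (n * b) ≤ N) :
    (1 / ((M : ℝ) * N)) ^ t ≤ (((2 : ℝ) ^ (-(a + b))) ^ t) ^ n := by
  have h1 : (0 : ℝ) < 2 ^ (n * a) := by positivity
  have h2 : (0 : ℝ) < 2 ^ (n * b) := by positivity
  have h3 : (((2 : ℝ) ^ (-(a + b))) ^ t) ^ n = (1 / ((2 : ℝ) ^ (n * a) * (2 : ℝ) ^ (n * b))) ^ t := by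
    rw [← Real.rpow_natCast, ← Real.rpow_add two_pos, one_div, ← Real.rpow_neg two_pos.le,
      ← Real.rpow_mul two_pos.le, ← Real.rpow_mul two_pos.le, ← Real.rpow_mul two_pos.le]
    congr 1
    ring
  rw [h3]
  gcongr

/-- The outer bound on the achievable rates. -/
lemma mem_stuckFaultRegion_of_achievable (hp : p ∈ Set.Icc (0 : ℝ) 1) {R : Fin 3 → ℝ}
    (hR : ∀ i, 0 ≤ R i) (h : (stuckFaultChannel p hp).Achievable R) : R ∈ stuckFaultRegion p := by
  obtain ⟨c, hc⟩ := h
  have hM (i : Fin 3) (n : ℕ) : 0 < ⌈(2 : ℝ) ^ ((n : ℝ) * R i)⌉₊ := Nat.ceil_pos.2 (by positivity)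
  have hM' (i : Fin 3) (n : ℕ) := Nat.le_ceil ((2 : ℝ) ^ ((n : ℝ) * R i))
  have hp' : 0 ≤ 1 - p := by linarith [hp.2]
  have hp0 := hp.1
  refine ⟨hR, ?_, ?_⟩
  · by_contra! hlt
    obtain ⟨t, ht, ht1, hθ⟩ := exists_rpow_lt_one (p := p) (c := Fintype.card (Fin 4))
      (d := 2 ^ (-(R 0 + R 1))) (by simp) (by positivity) (by
        have h4 := logb_card_four
        rw [Real.logb, div_eq_iff (Real.log_pos one_lt_two).ne'] at h4
        rw [h4, Real.log_rpow two_pos]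
        have := mul_lt_mul_of_pos_right hlt (Real.log_pos one_lt_two)
        linarith)
    refine not_tendsto_of_one_sub_le (by positivity) hθ (fun n => ?_) hc
    have : Nonempty (Fin ⌈(2 : ℝ) ^ ((n : ℝ) * R 0)⌉₊ × Fin ⌈(2 : ℝ) ^ ((n : ℝ) * R 1)⌉₊ ×
      Fin ⌈(2 : ℝ) ^ ((n : ℝ) * R 2)⌉₊) := ⟨⟨0, hM 0 n⟩, ⟨0, hM 1 n⟩, ⟨0, hM 2 n⟩⟩
    rw [one_sub_errorProb hp (hM 0 n) (hM 1 n) (hM 2 n), mul_pow]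
    refine (success_le hp id _ (cellContent (c n)) (fun m => m.2.2)
      (fun m s => stuckOutput_mem_consistentWords id _ s) ?_ ht ht1).trans ?_
    · intro m m' s hm hm' hw hs
      have := hm'.1
      rw [← hw, ← hs, hm.1, Prod.mk.injEq] at this
      exact Prod.ext this.1 (Prod.ext this.2 hs)
    · gcongr
      -- The known message `M₂` cancels, leaving one over the number of pairs that receiver 1 must
      -- tell apart.
      refine le_trans (le_of_eq ?_) (inv_mul_inv_rpow_le ht (hM' 0 n) (hM' 1 n))
      have h0 := hM 0 n
      have h1 := hM 1 n
      have h2 := hM 2 n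
      rw [Fintype.card_prod, Fintype.card_prod, Fintype.card_fin, Fintype.card_fin,
        Fintype.card_fin]
      push_cast
      congr 1
      field_simp
  · by_contra! hlt
    obtain ⟨t, ht, ht1, hθ⟩ := exists_rpow_lt_one (p := p) (c := Fintype.card (Fin 2))
      (d := 2 ^ (-(R 0 + R 2))) (by simp) (by positivity) (by
        rw [Fintype.card_fin, Nat.cast_ofNat, Real.log_rpow two_pos]
        have := mul_lt_mul_of_pos_right hlt (Real.log_pos one_lt_two)
        linarith)
    refine not_tendsto_of_one_sub_le (by positivity) hθ (fun n => ?_) hc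
    have : Nonempty (Fin ⌈(2 : ℝ) ^ ((n : ℝ) * R 0)⌉₊ × Fin ⌈(2 : ℝ) ^ ((n : ℝ) * R 1)⌉₊ ×
      Fin ⌈(2 : ℝ) ^ ((n : ℝ) * R 2)⌉₊) := ⟨⟨0, hM 0 n⟩, ⟨0, hM 1 n⟩, ⟨0, hM 2 n⟩⟩
    rw [one_sub_errorProb hp (hM 0 n) (hM 1 n) (hM 2 n), mul_pow]
    refine (success_le hp merge _ (fun m s i => merge (cellContent (c n) m s i)) (fun m => m.2.1)
      (fun m s => stuckOutput_mem_consistentWords merge _ s) ?_ ht ht1).trans ?_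
    · intro m m' s hm hm' hw hs
      have := hm'.2
      rw [← hw, ← hs, hm.2, Prod.mk.injEq] at this
      exact Prod.ext this.1 (Prod.ext hs this.2)
    · gcongr
      refine le_trans (le_of_eq ?_) (inv_mul_inv_rpow_le ht (hM' 0 n) (hM' 2 n))
      have h0 := hM 0 n
      have h1 := hM 1 n
      have h2 := hM 2 n
      rw [Fintype.card_prod, Fintype.card_prod, Fintype.card_fin, Fintype.card_fin,
        Fintype.card_fin]
      push_cast
      congr 1
      field_simp

end Converse

/-! ### Random binning of binary words. -/

section Binning

variable {n : ℕ} {p : ℝ}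

/-- From `1 - x ≤ exp (-x)` and `y ≤ exp y`. This weak bound suffices, since only a fractional power
of `A / k` is used. -/
lemma one_sub_inv_pow_le {A k : ℕ} (hA : 0 < A) (hk : 0 < k) :
    (1 - 1 / (A : ℝ)) ^ k ≤ A / k := by
  have hA' : (1 : ℝ) ≤ A := by exact_mod_cast hA
  have hk' : (0 : ℝ) < k := by exact_mod_cast hk
  have h1 : (1 - 1 / (A : ℝ)) ^ k ≤ Real.exp (-(k / A)) := by
    have h2 : 1 - 1 / (A : ℝ) ≤ Real.exp (-(1 / A)) := by
      linarith [Real.add_one_le_exp (-(1 / (A : ℝ)))]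
    have h3 : 0 ≤ 1 - 1 / (A : ℝ) := by
      rw [sub_nonneg, div_le_one (by linarith)]
      exact hA'
    refine (pow_le_pow_left₀ h3 h2 k).trans_eq ?_
    rw [← Real.exp_nat_mul]
    congr 1
    ring
  have h4 : (k : ℝ) / A ≤ Real.exp (k / A) := by linarith [Real.add_one_le_exp ((k : ℝ) / A)]
  refine h1.trans ?_
  rw [Real.exp_neg, ← inv_div (k : ℝ) A]
  gcongr

/-- The proportion of the binnings in which no element of `T` is in the bin `a`. -/
lemma card_avoiding {W A : Type} [Fintype W] [DecidableEq W] [Fintype A] [DecidableEq A]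
    (T : Finset W) (hT : T.Nonempty) (a : A) {t : ℝ} (ht : 0 < t) (ht1 : t ≤ 1) :
    ((Finset.univ.filter fun g : W → A => ∀ w ∈ T, g w ≠ a).card : ℝ) ≤
      Fintype.card (W → A) * ((Fintype.card A : ℝ) / T.card) ^ t := by
  have hA : 0 < Fintype.card A := Fintype.card_pos_iff.2 ⟨a⟩
  have hA' : (1 : ℝ) ≤ Fintype.card A := by exact_mod_cast hA
  -- These binnings form a product set: each word of `T` loses one of the bins, and the others are
  -- free.
  have h : (Finset.univ.filter fun g : W → A => ∀ w ∈ T, g w ≠ a) =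
      Fintype.piFinset fun w => if w ∈ T then Finset.univ.erase a else Finset.univ := by
    ext g
    simp only [Finset.mem_filter, Finset.mem_univ, true_and, Fintype.mem_piFinset]
    refine forall_congr' fun w => ?_
    by_cases hw : w ∈ T <;> simp [hw]
  have h2 : ((Finset.univ.filter fun g : W → A => ∀ w ∈ T, g w ≠ a).card : ℝ) =
      Fintype.card (W → A) * (1 - 1 / (Fintype.card A : ℝ)) ^ T.card := by
    rw [h, Fintype.card_piFinset, Fintype.card_fun, ← Finset.card_univ (α := W), Nat.cast_pow,
      ← Finset.prod_const, Nat.cast_prod, ← Finset.prod_const, ← Finset.prod_ite_mem_eq T,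
      ← Finset.prod_mul_distrib]
    refine Finset.prod_congr rfl fun w _ => ?_
    by_cases hw : w ∈ T
    · simp only [hw, if_true, Finset.card_erase_of_mem (Finset.mem_univ a), Finset.card_univ]
      rw [Nat.cast_sub hA]
      field_simp
      simp
    · simp [hw]
  rw [h2]
  gcongr
  have h3 : (0 : ℝ) ≤ 1 - 1 / (Fintype.card A : ℝ) := by
    rw [sub_nonneg, div_le_one (by linarith)]
    exact hA'
  refine le_rpow_of_le (pow_nonneg h3 _) (pow_le_one₀ h3 ?_) ?_ ht ht1
  · rw [sub_le_self_iff]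
    positivity
  · exact one_sub_inv_pow_le hA hT.card_pos

open scoped Classical in
/-- Random binning for one layer: there is a binning of the words such that, for most messages and
states, the bin of the message contains a word that agrees with the stuck cells. -/
lemma exists_binning {𝓜 A : Type} [Fintype 𝓜] [Fintype A] [Nonempty A]
    (hp : p ∈ Set.Icc (0 : ℝ) 1) (n : ℕ) (π : Fin 4 → Fin 2) (φ : 𝓜 → A) {t : ℝ} (ht : 0 < t)
    (ht1 : t ≤ 1) :
    ∃ g : (Fin n → Fin 2) → A,
      ∑ m, ∑ s, (if ∀ w ∈ consistentWords π s, g w ≠ φ m then faultProb p s else 0) ≤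
        Fintype.card 𝓜 * ((Fintype.card A : ℝ) ^ t * (p + (1 - p) * (1 / 2 : ℝ) ^ t) ^ n) := by
  have key : ∑ g : (Fin n → Fin 2) → A, ∑ m, ∑ s,
      (if ∀ w ∈ consistentWords π s, g w ≠ φ m then faultProb p s else 0) ≤
      ∑ g : (Fin n → Fin 2) → A, Fintype.card 𝓜 *
        ((Fintype.card A : ℝ) ^ t * (p + (1 - p) * (1 / 2 : ℝ) ^ t) ^ n) := by
    rw [Finset.sum_comm, Finset.sum_const, Finset.card_univ, nsmul_eq_mul, mul_left_comm,
      ← nsmul_eq_mul, ← Finset.card_univ, ← Finset.sum_const]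
    refine Finset.sum_le_sum fun m _ => ?_
    rw [Finset.sum_comm]
    have e := sum_faultProb_mul_card_rpow (n := n) (p := p) π (-t)
    rw [Fintype.card_fin, Nat.cast_ofNat, Real.rpow_neg two_pos.le, ← Real.inv_rpow two_pos.le,
      ← one_div] at e
    rw [← e, Finset.mul_sum, Finset.mul_sum]
    refine Finset.sum_le_sum fun s _ => ?_
    have hT := card_consistentWords_pos π s
    rw [← Finset.sum_filter, Finset.sum_const, nsmul_eq_mul, Real.rpow_neg hT.le]
    calc _ ≤ Fintype.card ((Fin n → Fin 2) → A) *
          ((Fintype.card A : ℝ) / (consistentWords π s).card) ^ t * faultProb p s := by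
          refine mul_le_mul_of_nonneg_right ?_ (faultProb_nonneg hp s)
          exact card_avoiding _ (Finset.card_pos.1 (by exact_mod_cast hT)) (φ m) ht ht1
      _ = _ := by
          rw [Real.div_rpow (by positivity) hT.le]
          ring
  -- The bound holds on average over all binnings, hence for one of them.
  obtain ⟨g, -, hg⟩ := Finset.exists_le_of_sum_le Finset.univ_nonempty key
  exact ⟨g, hg⟩

end Binning

/-! ### Two-layer codes. -/

section Code

variable {n M₀ M₁ M₂ : ℕ} {p : ℝ}

open scoped Classical in
/-- Layered coding: the payload `φ m` is stored in the merged bits and `ψ m` in the parities. -/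
lemma exists_code {A B : Type} [Fintype A] [Fintype B] (hp : p ∈ Set.Icc (0 : ℝ) 1) (n : ℕ)
    (φ : Fin M₀ × Fin M₁ × Fin M₂ → A) (ψ : Fin M₀ × Fin M₁ × Fin M₂ → B)
    (h₀ : 0 < M₀) (h₁ : 0 < M₁) (h₂ : 0 < M₂)
    (hdec₁ : ∀ m m', φ m = φ m' → ψ m = ψ m' → m.2.2 = m'.2.2 → m = m')
    (hdec₂ : ∀ m m', φ m = φ m' → m.2.1 = m'.2.1 → m = m') {t : ℝ} (ht : 0 < t)
    (ht1 : t ≤ 1) :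
    ∃ c : Code (Fin 4) (Option (Fin 4)) (Fin 4) (Fin 2) n M₀ M₁ M₂,
      (stuckFaultChannel p hp).errorProb c ≤
        ((Fintype.card A : ℝ) ^ t + (Fintype.card B : ℝ) ^ t) *
          (p + (1 - p) * (1 / 2 : ℝ) ^ t) ^ n := by
  let m₀ : Fin M₀ × Fin M₁ × Fin M₂ := (⟨0, h₀⟩, ⟨0, h₁⟩, ⟨0, h₂⟩)
  have : Nonempty A := ⟨φ m₀⟩
  have : Nonempty B := ⟨ψ m₀⟩
  obtain ⟨g, hg⟩ := exists_binning hp n merge φ ht ht1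
  obtain ⟨g', hg'⟩ := exists_binning hp n parity ψ ht ht1
  have hw (m s) : ∃ w, (∃ w ∈ consistentWords merge s, g w = φ m) →
      w ∈ consistentWords merge s ∧ g w = φ m := by
    by_cases h : ∃ w ∈ consistentWords merge s, g w = φ m
    · exact ⟨h.choose, fun _ => h.choose_spec⟩
    · exact ⟨0, fun h' => absurd h' h⟩
  have hv (m s) : ∃ w, (∃ w ∈ consistentWords parity s, g' w = ψ m) →
      w ∈ consistentWords parity s ∧ g' w = ψ m := by
    by_cases h : ∃ w ∈ consistentWords parity s, g' w = ψ m
    · exact ⟨h.choose, fun _ => h.choose_spec⟩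
    · exact ⟨0, fun h' => absurd h' h⟩
  choose w hw using hw
  choose v hv using hv
  -- Any message that fits the two observed bins and the side information will do: by `hdec₁` there
  -- is at most one.
  have hd₁ (y : Fin n → Fin 4) (k : Fin M₂) : ∃ d : Fin M₀ × Fin M₁, ∀ m,
      φ m = g (fun i => merge (y i)) → ψ m = g' (fun i => parity (y i)) → m.2.2 = k →
        d = (m.1, m.2.1) := by
    by_cases h : ∃ m, φ m = g (fun i => merge (y i)) ∧ ψ m = g' (fun i => parity (y i)) ∧ m.2.2 = k
    · obtain ⟨m, e1, e2, e3⟩ := h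
      refine ⟨(m.1, m.2.1), fun m' e1' e2' e3' => ?_⟩
      rw [hdec₁ m m' (e1.trans e1'.symm) (e2.trans e2'.symm) (e3.trans e3'.symm)]
    · exact ⟨(m₀.1, m₀.2.1), fun m e1 e2 e3 => absurd ⟨m, e1, e2, e3⟩ h⟩
  have hd₂ (y : Fin n → Fin 2) (k : Fin M₁) : ∃ d : Fin M₀ × Fin M₂, ∀ m,
      φ m = g y → m.2.1 = k → d = (m.1, m.2.2) := by
    by_cases h : ∃ m, φ m = g y ∧ m.2.1 = k
    · obtain ⟨m, e1, e3⟩ := h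
      refine ⟨(m.1, m.2.2), fun m' e1' e3' => ?_⟩
      rw [hdec₂ m m' (e1.trans e1'.symm) (e3.trans e3'.symm)]
    · exact ⟨(m₀.1, m₀.2.2), fun m e1 e3 => absurd ⟨m, e1, e3⟩ h⟩
  choose d₁ hd₁ using hd₁
  choose d₂ hd₂ using hd₂
  let c : Code (Fin 4) (Option (Fin 4)) (Fin 4) (Fin 2) n M₀ M₁ M₂ :=
    ⟨fun m s i => ofBits (w m s i) (v m s i), d₁, d₂⟩
  have hc (m s) (h1 : ∃ w ∈ consistentWords merge s, g w = φ m)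
      (h2 : ∃ w ∈ consistentWords parity s, g' w = ψ m) : Correct c m s := by
    obtain ⟨a1, a2⟩ := hw m s h1
    obtain ⟨b1, b2⟩ := hv m s h2
    have e1 : (fun i => merge (cellContent c m s i)) = w m s := by
      funext i
      rw [cellContent]
      cases hs : s i with
      | none => exact merge_ofBits _ _
      -- The input is lost in a stuck cell, but the chosen word already carries the bit of the stuck
      -- symbol.
      | some j => exact (mem_consistentWords.1 a1 i j hs).symm
    have e2 : (fun i => parity (cellContent c m s i)) = v m s := by
      funext i
      rw [cellContent]
      cases hs : s i with
      | none => exact parity_ofBits _ _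
      | some j => exact (mem_consistentWords.1 b1 i j hs).symm
    exact ⟨hd₁ _ _ m (by rw [e1, a2]) (by rw [e2, b2]) rfl, hd₂ _ _ m (by rw [e1, a2]) rfl⟩
  refine ⟨c, ?_⟩
  have hM : (0 : ℝ) < (M₀ : ℝ) * M₁ * M₂ := by positivity
  rw [errorProb_eq, div_le_iff₀ hM]
  have hcard : (Fintype.card (Fin M₀ × Fin M₁ × Fin M₂) : ℝ) = (M₀ : ℝ) * M₁ * M₂ := by
    simp [mul_assoc]
  rw [hcard] at hg hg'
  -- Union bound: an error requires that one of the layers finds no suitable word.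
  refine (?_ : _ ≤ ∑ m, ∑ s, (if ∀ w ∈ consistentWords merge s, g w ≠ φ m then faultProb p s
    else 0) + ∑ m, ∑ s, (if ∀ w ∈ consistentWords parity s, g' w ≠ ψ m then faultProb p s
    else 0)).trans ((add_le_add hg hg').trans_eq (by ring))
  simp_rw [← Finset.sum_add_distrib]
  refine Finset.sum_le_sum fun m _ => Finset.sum_le_sum fun s _ => ?_
  have h0 := faultProb_nonneg hp s
  by_cases h1 : ∃ w ∈ consistentWords merge s, g w = φ m
  · by_cases h2 : ∃ w ∈ consistentWords parity s, g' w = ψ m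
    · rw [if_pos (hc m s h1 h2)]
      exact add_nonneg (by split_ifs <;> simp [h0]) (by split_ifs <;> simp [h0])
    · push Not at h2
      rw [if_pos h2]
      refine le_add_of_nonneg_of_le (by split_ifs <;> simp [h0]) (by split_ifs <;> simp [h0])
  · push Not at h1
    rw [if_pos h1]
    refine le_add_of_le_of_nonneg (by split_ifs <;> simp [h0]) (by split_ifs <;> simp [h0])

/-- Payloads for message sets of arbitrary sizes: `m₁` is split into a part below `N`, which is
added to `m₂` in the first layer, and a part below `B`, which is stored in the second layer. -/
lemma exists_code_of_le {N B : ℕ} (hp : p ∈ Set.Icc (0 : ℝ) 1) (n : ℕ)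
    (h₀ : 0 < M₀) (h₁ : 0 < M₁) (h₂ : 0 < M₂) (hB : 0 < B) (hNB : M₁ ≤ N * B) {t : ℝ} (ht : 0 < t)
    (ht1 : t ≤ 1) :
    ∃ c : Code (Fin 4) (Option (Fin 4)) (Fin 4) (Fin 2) n M₀ M₁ M₂,
      (stuckFaultChannel p hp).errorProb c ≤
        (((M₀ * max N M₂ : ℕ) : ℝ) ^ t + (B : ℝ) ^ t) * (p + (1 - p) * (1 / 2 : ℝ) ^ t) ^ n := by
  have hL : 0 < max N M₂ := lt_max_of_lt_right h₂
  have : NeZero (max N M₂) := ⟨hL.ne'⟩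
  have hN (a : Fin M₁) : a.val / B < N := Nat.div_lt_of_lt_mul
    ((a.2.trans_le hNB).trans_eq (mul_comm _ _))
  -- The modulus `max N M₂` is large enough for both summands, so each can be recovered from the sum
  -- and the other.
  have hcast {a b : ℕ} (ha : a < max N M₂) (hb : b < max N M₂)
      (h : (a : ZMod (max N M₂)) = b) : a = b := by
    have := congrArg ZMod.val h
    rwa [ZMod.val_cast_of_lt ha, ZMod.val_cast_of_lt hb] at this
  obtain ⟨c, hc⟩ := exists_code hp n
    (fun m : Fin M₀ × Fin M₁ × Fin M₂ =>
      (m.1, ((m.2.1.val / B : ℕ) : ZMod (max N M₂)) + (m.2.2.val : ℕ)))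
    (fun m => (⟨m.2.1.val % B, Nat.mod_lt _ hB⟩ : Fin B)) h₀ h₁ h₂
    (fun m m' e1 e2 e3 => by
      rw [Prod.mk.injEq, e3, add_left_inj] at e1
      rw [Fin.mk.injEq] at e2
      have := hcast ((hN _).trans_le (le_max_left _ _)) ((hN _).trans_le (le_max_left _ _)) e1.2
      refine Prod.ext e1.1 (Prod.ext (Fin.ext ?_) e3)
      rw [← Nat.div_add_mod m.2.1.val B, this, e2, Nat.div_add_mod])
    (fun m m' e1 e2 => by
      rw [Prod.mk.injEq, e2, add_right_inj] at e1
      have := hcast (m.2.2.2.trans_le (le_max_right _ _)) (m'.2.2.2.trans_le (le_max_right _ _)) e1.2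
      exact Prod.ext e1.1 (Prod.ext e2 (Fin.ext this))) ht ht1
  refine ⟨c, hc.trans_eq ?_⟩
  rw [Fintype.card_prod, Fintype.card_fin, Fintype.card_fin, ZMod.card]

end Code

/-! ### Choice of rates and the capacity region. -/

section Achievability

variable {p : ℝ}

lemma natCeil_two_rpow_le {x : ℝ} (hx : 0 ≤ x) : (⌈(2 : ℝ) ^ x⌉₊ : ℝ) ≤ 2 * 2 ^ x := by
  have h1 := Real.one_le_rpow one_le_two hx
  have h2 := Nat.ceil_lt_add_one (a := (2 : ℝ) ^ x) (by positivity)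
  linarith

lemma achievable_of_lt (hp : p ∈ Set.Icc (0 : ℝ) 1) (hp1 : p < 1) {R : Fin 3 → ℝ}
    (hR : ∀ i, 0 ≤ R i) (h1 : R 0 + R 1 < 2 - 2 * p) (h2 : R 0 + R 2 < 1 - p) :
    (stuckFaultChannel p hp).Achievable R := by
  have hp0 := hp.1
  have hp' : 0 ≤ 1 - p := by linarith
  have hR0 := hR 0
  have hR1 := hR 1
  have hR2 := hR 2
  -- `r` is the rate of the second layer; the lower bound lets the remainder `R 1 - r` fit beside `R
  -- 0` in the first.
  obtain ⟨r, hr1, hr2⟩ := exists_between (max_lt (by linarith : (0 : ℝ) < 1 - p)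
    (by linarith : R 0 + R 1 - (1 - p) < 1 - p))
  rw [max_lt_iff] at hr1
  set x := max (R 1 - r) 0 with hx
  have hx0 : 0 ≤ x := le_max_right _ _
  -- `ρ` exceeds the rates of both layers and is still below `1 - p`, so one `t` serves both.
  obtain ⟨ρ, hρ1, hρ2⟩ : ∃ ρ, max r (R 0 + max x (R 2)) < ρ ∧ ρ < 1 - p := by
    refine exists_between (max_lt hr2 ?_)
    rw [← lt_sub_iff_add_lt', max_lt_iff, hx, max_lt_iff]
    refine ⟨⟨?_, ?_⟩, ?_⟩ <;> linarith
  rw [max_lt_iff] at hρ1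
  obtain ⟨t, ht, ht1, hθ⟩ := exists_rpow_lt_one (p := p) (c := 1 / 2) (d := 2 ^ ρ) (by norm_num)
    (by positivity) (by
      rw [one_div, Real.log_inv, Real.log_rpow two_pos]
      have := mul_lt_mul_of_pos_right hρ2 (Real.log_pos one_lt_two)
      linarith)
  have hpos (y : ℝ) : 0 < ⌈(2 : ℝ) ^ y⌉₊ := Nat.ceil_pos.2 (by positivity)
  have hNB (n : ℕ) : ⌈(2 : ℝ) ^ ((n : ℝ) * R 1)⌉₊ ≤
      ⌈(2 : ℝ) ^ ((n : ℝ) * x)⌉₊ * ⌈(2 : ℝ) ^ ((n : ℝ) * r)⌉₊ := by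
    rw [Nat.ceil_le]
    push_cast
    calc (2 : ℝ) ^ ((n : ℝ) * R 1) ≤ 2 ^ ((n : ℝ) * x + n * r) := by
          refine Real.rpow_le_rpow_of_exponent_le one_le_two ?_
          rw [← mul_add]
          have := le_max_left (R 1 - r) 0
          exact mul_le_mul_of_nonneg_left (by linarith) n.cast_nonneg
      _ = 2 ^ ((n : ℝ) * x) * 2 ^ ((n : ℝ) * r) := Real.rpow_add two_pos _ _
      _ ≤ _ := mul_le_mul (Nat.le_ceil _) (Nat.le_ceil _) (by positivity) (by positivity)
  choose c hc using fun n : ℕ => exists_code_of_le hp n (hpos (n * R 0)) (hpos (n * R 1))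
    (hpos (n * R 2)) (hpos (n * r)) (hNB n) ht ht1
  refine ⟨c, ?_⟩
  have hlim : Tendsto (fun n : ℕ =>
      (2 * (4 : ℝ) ^ t) * ((p + (1 - p) * (1 / 2 : ℝ) ^ t) * ((2 : ℝ) ^ ρ) ^ t) ^ n) atTop (𝓝 0) := by
    simpa using (tendsto_pow_atTop_nhds_zero_of_lt_one (by positivity) hθ).const_mul
      (2 * (4 : ℝ) ^ t)
  refine squeeze_zero (fun n => ?_) (fun n => (hc n).trans ?_) hlim
  · classical
    rw [errorProb_eq]
    refine div_nonneg (Finset.sum_nonneg fun m _ => Finset.sum_nonneg fun s _ => ?_)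
      (by positivity)
    have := faultProb_nonneg hp s
    split_ifs <;> simp [this]
  · have hn : (0 : ℝ) ≤ n := n.cast_nonneg
    have hmono {a b : ℝ} (h : a ≤ b) : (2 : ℝ) ^ ((n : ℝ) * a) ≤ 2 ^ ((n : ℝ) * b) :=
      Real.rpow_le_rpow_of_exponent_le one_le_two (mul_le_mul_of_nonneg_left h hn)
    -- Rounding up costs a factor 2 per message set. The first layer stores a product of two, hence
    -- 4; the same constant is used here.
    have hB : (⌈(2 : ℝ) ^ ((n : ℝ) * r)⌉₊ : ℝ) ≤ 4 * 2 ^ ((n : ℝ) * ρ) := by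
      have e1 := natCeil_two_rpow_le (mul_nonneg hn hr1.1.le)
      have e2 := hmono hρ1.1.le
      have e3 : (0 : ℝ) < 2 ^ ((n : ℝ) * r) := by positivity
      linarith
    have hA : ((⌈(2 : ℝ) ^ ((n : ℝ) * R 0)⌉₊ * max ⌈(2 : ℝ) ^ ((n : ℝ) * x)⌉₊
        ⌈(2 : ℝ) ^ ((n : ℝ) * R 2)⌉₊ : ℕ) : ℝ) ≤ 4 * 2 ^ ((n : ℝ) * ρ) := by
      push_cast
      calc _ ≤ (2 * 2 ^ ((n : ℝ) * R 0)) * (2 * (2 : ℝ) ^ ((n : ℝ) * max x (R 2))) := by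
            refine mul_le_mul (natCeil_two_rpow_le (mul_nonneg hn hR0)) (max_le ?_ ?_)
              (by positivity) (by positivity)
            · refine (natCeil_two_rpow_le (mul_nonneg hn hx0)).trans ?_
              exact mul_le_mul_of_nonneg_left (hmono (le_max_left _ _)) two_pos.le
            · refine (natCeil_two_rpow_le (mul_nonneg hn hR2)).trans ?_
              exact mul_le_mul_of_nonneg_left (hmono (le_max_right _ _)) two_pos.le
        _ = 4 * 2 ^ ((n : ℝ) * (R 0 + max x (R 2))) := by
            rw [mul_add, Real.rpow_add two_pos]
            ring
        _ ≤ _ := mul_le_mul_of_nonneg_left (hmono hρ1.2.le) (by norm_num)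
    have e : (4 * (2 : ℝ) ^ ((n : ℝ) * ρ)) ^ t = 4 ^ t * (((2 : ℝ) ^ ρ) ^ t) ^ n := by
      rw [Real.mul_rpow (by norm_num) (by positivity), ← Real.rpow_natCast,
        ← Real.rpow_mul two_pos.le, ← Real.rpow_mul two_pos.le, ← Real.rpow_mul two_pos.le]
      congr 2
      ring
    rw [mul_pow, ← mul_assoc, mul_right_comm]
    refine mul_le_mul_of_nonneg_right ?_ (by positivity)
    have eA := Real.rpow_le_rpow (by positivity) hA ht.le
    have eB := Real.rpow_le_rpow (by positivity) hB ht.le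
    rw [e] at eA eB
    linarith

/-- The capacity region of the stuck-fault channel. -/
lemma capacityRegion_eq (hp : p ∈ Set.Icc (0 : ℝ) 1) (hp1 : p < 1) :
    (stuckFaultChannel p hp).capacityRegion = stuckFaultRegion p := by
  refine Set.Subset.antisymm (closure_minimal
    (fun R hR => mem_stuckFaultRegion_of_achievable hp hR.1 hR.2)
    (isClosed_stuckFaultRegion p)) ?_
  rintro R ⟨hR, h1, h2⟩
  -- Scaling by `a < 1` makes both rate constraints strict, since their right sides are positive.
  have hlim : Tendsto (fun a : ℝ => a • R) (𝓝[<] 1) (𝓝 R) := by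
    have : Tendsto (fun a : ℝ => a • R) (𝓝 1) (𝓝 ((1 : ℝ) • R)) :=
      (continuous_id.smul continuous_const).tendsto 1
    rw [one_smul] at this
    exact this.mono_left nhdsWithin_le_nhds
  refine mem_closure_of_tendsto hlim ?_
  filter_upwards [Ioo_mem_nhdsLT (zero_lt_one (α := ℝ))] with a ha
  have hlt {x y : ℝ} (hx : 0 ≤ x) (hxy : x ≤ y) (hy : 0 < y) : a * x < y :=
    (mul_le_mul_of_nonneg_left hxy ha.1.le).trans_lt (mul_lt_of_lt_one_left hy ha.2)
  refine ⟨fun i => mul_nonneg ha.1.le (hR i),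
    achievable_of_lt hp hp1 (fun i => mul_nonneg ha.1.le (hR i)) ?_ ?_⟩
  · simpa [mul_add] using hlt (add_nonneg (hR 0) (hR 1)) h1 (by linarith)
  · simpa [mul_add] using hlt (add_nonneg (hR 0) (hR 2)) h2 (by linarith)

end Achievability

end BCSI

end

open BCSI in
theorem proposition4 (p : ℝ) (hp0 : 0 < p) (hp1 : p < 1) :
    (stuckFaultChannel p ⟨hp0.le, hp1.le⟩).capacityRegion =
        {R : Fin 3 → ℝ | (∀ i, 0 ≤ R i) ∧ R 0 + R 1 ≤ 2 - 2 * p ∧ R 0 + R 2 ≤ 1 - p} ∧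
      (stuckFaultChannel p ⟨hp0.le, hp1.le⟩).twoLayerRegion =
        (stuckFaultChannel p ⟨hp0.le, hp1.le⟩).capacityRegion ∧
      (stuckFaultChannel p ⟨hp0.le, hp1.le⟩).twoLayerRegionOfSize 2 2 =
        (stuckFaultChannel p ⟨hp0.le, hp1.le⟩).capacityRegion ∧
      closure (stuckFaultChannel p ⟨hp0.le, hp1.le⟩).gelfandPinskerRegion ⊂
        (stuckFaultChannel p ⟨hp0.le, hp1.le⟩).capacityRegion := by
  have hp : p ∈ Set.Icc (0 : ℝ) 1 := ⟨hp0.le, hp1.le⟩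
  have hc := capacityRegion_eq hp hp1
  have hsub := stuckFaultRegion_subset hp hp1
  refine ⟨hc, ?_, ?_, ?_⟩
  -- Every alphabet size stays inside the region, and sizes 2 and 2 already fill it.
  · refine Set.Subset.antisymm (Set.iUnion₂_subset fun k₁ k₂ => ?_) ?_
    · exact (twoLayerRegionOfSize_subset hp k₁ k₂).trans hc.ge
    · exact hc.le.trans (hsub.trans (Set.subset_iUnion₂_of_subset 2 2 subset_rfl))
  · exact Set.Subset.antisymm ((twoLayerRegionOfSize_subset hp 2 2).trans hc.ge)
      (hc.le.trans hsub)
  · exact (closure_gelfandPinskerRegion_ssubset hp0 hp1).trans_subset hc.ge
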